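/- A relational schema $\sigma$ is a finite set of relation names, each with a fixed arity $\ge 0$. A conjunctive query (CQ) of arity $\alpha\ge 0$ over $\sigma$ is a rule $(z_1,\dots,z_\alpha)\leftarrow S_1(\overline x_1),\dots,S_n(\overline x_n)$ with $n>0$, where each $S_j\in\sigma$, each $\overline x_j$ is a list of variables of length $\mathrm{arity}(S_j)$, and every head variable $z_i$ occurs in the body. It is a 2CQ if each relation name occurs at most twice in the body; $2CQ_{\sigma,\alpha}$ denotes the set of 2CQs of arity $\alpha$ over $\sigma$. For a finite instance $I$ of $\sigma$ over an infinite domain of constants, $Q(I)$ is the set of tuples $(h(z_1),\dots,h(z_\alpha))$ where $h$ maps variables to constants so that every body atom becomes a fact of $I$. Write $Q_1\sqsubseteq Q_2$ if $Q_1(I)\subseteq Q_2(I)$ for every instance $I$, and $Q_1\equiv Q_2$ if $Q_1\sqsubseteq Q_2$ and $Q_2\sqsubseteq Q_1$. For $Q_1,Q_2\in 2CQ_{\sigma,\alpha}$ write $Q_1\sqsubseteq_m Q_2$ ($Q_1$ is maximally contained in $Q_2$) if $Q_1\sqsubseteq Q_2$, $Q_2\not\sqsubseteq Q_1$, and every $Q\in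 2CQ_{\sigma,\alpha}$ with $Q_1\sqsubseteq Q\sqsubseteq Q_2$ satisfies $Q_1\equiv Q$ or $Q\equiv Q_2$. The distance $\delta_\sqsubseteq(Q_1,Q_2)\in\mathbb N$ is defined as follows: - $\delta_\sqsubseteq(Q_1,Q_2)=0$ iff $Q_1\equiv Q_2$; - $\delta_\sqsubseteq(Q_1,Q_2)=1$ iff $Q_1\sqsubseteq_m Q_2$ or $Q_2\sqsubseteq_m Q_1$; - for $i>1$, $\delta_\sqsubseteq(Q_1,Q_2)=i$ iff $Q_1\not\equiv Q_2$, there is $Q\in 2CQ_{\sigma,\alpha}$ with $\delta_\sqsubseteq(Q_1,Q)=i-1$ and $\delta_\sqsubseteq(Q_2,Q)=1$, and there is no $Q'\in 2CQ_{\sigma,\alpha}$ with $\delta_\sqsubseteq(Q_1,Q')<i-1$ and $\delta_\sqsubseteq(Q_2,Q')=1$. **Theorem.** For every schema $\sigma$, every $\alpha$ and all $Q_1,Q_2\in 2CQ_{\sigma,\alpha}$, these clauses hold for exactly one $i\in\mathbb N$, so $\delta_\sqsubseteq(Q_1,Q_2)$ is well defined; and it can be computed in exponential time: there are a single (multi-stack)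 Turing machine and a polynomial $p$ such that, given $\sigma,Q_1,Q_2$ as input (the arities of the relation names written in unary, relation names and variables in binary), the machine outputs $\delta_\sqsubseteq(Q_1,Q_2)$ in binary within $2^{p(N)}$ steps, where $N$ is the length of the input. -/

import Mathlib

/-- A relational schema: finitely many relation names (here `0, …, numRel - 1`), each of a fixed
arity, which may be `0`. -/
structure Schema where
  numRel : ℕ
  arity : Fin numRel → ℕ

/-- The countably infinite set of variables. -/
abbrev Var : Type := ℕ

/-- The countably infinite domain of constants. -/
abbrev Const : Type := ℕ

/-- An expression `S(t₁, …, tₐ)` with `S` a relation name of `σ` of arity `a` and all `tᵢ` in `T`: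
an atom of a query for `T = Var`, a `σ`-fact for `T = Const`. -/
structure Atom (σ : Schema) (T : Type) where
  rel : Fin σ.numRel
  args : Fin (σ.arity rel) → T

/-- `S(t₁, …, tₐ) ↦ S(h t₁, …, h tₐ)`. -/
def Atom.map {σ : Schema} {T U : Type} (h : T → U) (A : Atom σ T) : Atom σ U where
  rel := A.rel
  args := fun j => h (A.args j)

/-- An instance of `σ`: a finite set of `σ`-facts. -/
abbrev Instance (σ : Schema) : Type := Finset (Atom σ Const)

/-- A conjunctive query of arity `α` over `σ`: a head, which is a list of `α` variables, possibly
with repetitions, and a non-empty list of atoms, the body, in which all head variables occur. -/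
structure CQ (σ : Schema) (α : ℕ) where
  head : Fin α → Var
  body : List (Atom σ Var)
  body_ne_nil : body ≠ []
  head_subset : ∀ i, ∃ A ∈ body, ∃ j, A.args j = head i

namespace CQ

variable {σ : Schema} {α : ℕ}

/-- `h` is an embedding of `Q` in `I`. -/
def IsEmbedding (Q : CQ σ α) (I : Instance σ) (h : Var → Const) : Prop :=
  ∀ A ∈ Q.body, A.map h ∈ I

/-- The answer `Q(I)`. -/
def eval (Q : CQ σ α) (I : Instance σ) : Set (Fin α → Const) :=
  {t | ∃ h : Var → Const, Q.IsEmbedding I h ∧ t = fun i => h (Q.head i)}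

/-- `Q₁ ⊑ Q₂`. -/
def Contained (Q₁ Q₂ : CQ σ α) : Prop :=
  ∀ I : Instance σ, Q₁.eval I ⊆ Q₂.eval I

/-- `Q₁ ≡ Q₂`. -/
def Equivalent (Q₁ Q₂ : CQ σ α) : Prop :=
  Q₁.Contained Q₂ ∧ Q₂.Contained Q₁

/-- Each relation name appears at most twice in the body. -/
def IsTwo (Q : CQ σ α) : Prop :=
  ∀ R : Fin σ.numRel, (Q.body.map Atom.rel).count R ≤ 2

end CQ

/-- The set of all 2CQs of arity `α` over `σ`. -/
abbrev TwoCQ (σ : Schema) (α : ℕ) : Type := {Q : CQ σ α // Q.IsTwo}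

namespace TwoCQ

variable {σ : Schema} {α : ℕ}

/-- `Q₁` is maximally contained in `Q₂`, within the class of 2CQs of arity `α` over `σ`. -/
def MaxContained (Q₁ Q₂ : TwoCQ σ α) : Prop :=
  Q₁.1.Contained Q₂.1 ∧ ¬ Q₂.1.Contained Q₁.1 ∧
    ∀ Q : TwoCQ σ α, Q₁.1.Contained Q.1 → Q.1.Contained Q₂.1 →
      Q₁.1.Equivalent Q.1 ∨ Q.1.Equivalent Q₂.1

/-- `IsDist Q₁ i Q₂` says that the containment-based distance of `Q₁` and `Q₂` is `i`. -/
def IsDist (Q₁ : TwoCQ σ α) : ℕ → TwoCQ σ α → Prop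
  | 0, Q₂ => Q₁.1.Equivalent Q₂.1
  | 1, Q₂ => Q₁.MaxContained Q₂ ∨ Q₂.MaxContained Q₁
  | i + 2, Q₂ =>
      ¬ Q₁.1.Equivalent Q₂.1 ∧
      (∃ Q : TwoCQ σ α, IsDist Q₁ (i + 1) Q ∧ (Q₂.MaxContained Q ∨ Q.MaxContained Q₂)) ∧
      ¬ ∃ (i' : ℕ) (_ : i' < i + 1) (Q' : TwoCQ σ α),
          IsDist Q₁ i' Q' ∧ (Q₂.MaxContained Q' ∨ Q'.MaxContained Q₂)
  termination_by i => i

end TwoCQ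

/-- An input of the distance problem: a schema and two 2CQs of the same arity over it. -/
structure DistInput where
  σ : Schema
  α : ℕ
  Q₁ : TwoCQ σ α
  Q₂ : TwoCQ σ α

/-- The input alphabet. -/
inductive InSymbol where
  | bit (b : Bool)
  | comma
  | semicolon

/-- A natural number in binary, followed by a comma. -/
def encodeNumber (n : ℕ) : List InSymbol :=
  (Computability.encodeNat n).map InSymbol.bit ++ [InSymbol.comma]

/-- A schema is written as the list of the arities of its relation names, in unary. -/
def encodeSchema (σ : Schema) : List InSymbol :=
  (List.ofFn σ.arity).flatMap
    (fun a => List.replicate a (InSymbol.bit true) ++ [InSymbol.comma]) ++ [InSymbol.semicolon]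

/-- An atom is written as its relation name followed by its variables. -/
def encodeAtom {σ : Schema} (A : Atom σ Var) : List InSymbol :=
  encodeNumber A.rel.val ++ (List.ofFn A.args).flatMap encodeNumber ++ [InSymbol.semicolon]

/-- A query is written as its head variables followed by its atoms. -/
def encodeQuery {σ : Schema} {α : ℕ} (Q : CQ σ α) : List InSymbol :=
  (List.ofFn Q.head).flatMap encodeNumber ++ [InSymbol.semicolon] ++
    Q.body.flatMap encodeAtom ++ [InSymbol.semicolon]

/-- The word on the input tape: the schema followed by the two queries. -/
def encodeInput (x : DistInput) : List InSymbol :=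
  encodeSchema x.σ ++ encodeQuery x.Q₁.1 ++ encodeQuery x.Q₂.1

/-! By the theorem of Chandra and Merlin (`CQ.contained_iff`), containment means existence of a
homomorphism. A 2CQ has at most two atoms per relation name, so at most twice the sum of the arities
many variables; renaming them (`CQ.IsTwo.exists_equivalent`) shows that up to equivalence there are
only finitely many 2CQs, namely `2 ^ O(N ^ 3)` for an input of length `N`.

Join two equivalence classes by an edge if one is maximally contained in the other. In a finite
preorder any two comparable elements are linked by a chain of such edges
(`TwoCQ.reflTransGen_of_contained`), and the query with one atom `R(0, …, 0)` for each `R` lies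
below all others (`TwoCQ.exists_bottom`). So the graph is connected. The recursive clauses of the
distance describe exactly the graph distance (`TwoCQ.isDist_iff_level`), which therefore exists and
is unique. A breadth-first search over a list of representatives finds it, since the number of
representatives bounds the number of rounds (`TwoCQ.reach_length`, `RawQuery.level_dist`).

For the running time the search has to become a Turing machine. Three layers do this: structured
stack programs are simulated by a machine (`Cmd.exists_computableInTime`); a small functional
language on binary trees, whose only recursion is the fold, is compiled to stack programs with an
explicit cost (`Code.runs_compile`); and functions computed by such codes in time polynomial in a
measure of the argument are closed under the usual list operations (`PolyTime`, in particular
`PolyTime.foldl_of_bdd`). The measure of an input is declared to be exponential in its length, so a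
search polynomial in the number of candidates is `PolyTime`, which for inputs means exponential
time. All enumerations are cut off at an explicit exponential bound. This makes their complexity
evident, and separate counting lemmas show that the cut-off never removes anything. -/

/-! ### Structured stack programs -/

/-- Programs over a family of stacks. `pop k f` pops the top of stack `k` and continues with `f`;
`loop k finish f` pops the top `o` of stack `k`, ends if `finish o`, and otherwise runs `f o` and
starts again. -/
inductive Cmd {K : Type} (Γ : K → Type) : Type
  | skip : Cmd Γ
  | push (k : K) (a : Γ k) : Cmd Γ
  | pop (k : K) (f : Option (Γ k) → Cmd Γ) : Cmd Γ
  | seq (c d : Cmd Γ) : Cmd Γ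
  | loop (k : K) (finish : Option (Γ k) → Bool) (f : Option (Γ k) → Cmd Γ) : Cmd Γ

namespace Cmd

variable {K : Type} {Γ : K → Type}

/-- The contents of all stacks. -/
abbrev Stacks (Γ : K → Type) : Type := ∀ k, List (Γ k)

/-- The subprograms of a program. -/
def subs : Cmd Γ → Set (Cmd Γ)
  | skip => {skip}
  | push k a => {push k a}
  | pop k f => insert (pop k f) (⋃ o, subs (f o))
  | seq c d => insert (seq c d) (subs c ∪ subs d)
  | loop k finish f => insert (loop k finish f) (⋃ o, subs (f o))

theorem mem_subs_self (c : Cmd Γ) : c ∈ subs c := by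
  cases c <;> simp [subs]

/-- The branches of `pop` and `loop` are indexed by the finite type `Option (Γ k)`. Hence the
subprograms can serve as the alphabet of a control stack. -/
theorem subs_finite [∀ k, Finite (Γ k)] (c : Cmd Γ) : (subs c).Finite := by
  induction c with
  | skip => simp [subs]
  | push k a => simp [subs]
  | pop k f ih => exact (Set.finite_iUnion ih).insert _
  | seq c d ihc ihd => exact (ihc.union ihd).insert _
  | loop k finish f ih => exact (Set.finite_iUnion ih).insert _

theorem subs_subset {c d : Cmd Γ} (h : c ∈ subs d) : subs c ⊆ subs d := by
  induction d with
  | skip => simp only [subs, Set.mem_singleton_iff] at h; subst h; exact subset_rfl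
  | push k a => simp only [subs, Set.mem_singleton_iff] at h; subst h; exact subset_rfl
  | pop k f ih =>
    rcases h with rfl | h
    · exact subset_rfl
    · obtain ⟨o, ho⟩ := Set.mem_iUnion.1 h
      exact (ih o ho).trans ((Set.subset_iUnion (fun o => subs (f o)) o).trans
        (Set.subset_insert _ _))
  | seq c d ihc ihd =>
    rcases h with rfl | h | h
    · exact subset_rfl
    · exact (ihc h).trans (Set.subset_union_left.trans (Set.subset_insert _ _))
    · exact (ihd h).trans (Set.subset_union_right.trans (Set.subset_insert _ _))
  | loop k finish f ih =>
    rcases h with rfl | h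
    · exact subset_rfl
    · obtain ⟨o, ho⟩ := Set.mem_iUnion.1 h
      exact (ih o ho).trans ((Set.subset_iUnion (fun o => subs (f o)) o).trans
        (Set.subset_insert _ _))

section Semantics

variable [DecidableEq K]

/-- One step of the execution of a list of programs. -/
def step : List (Cmd Γ) × Stacks Γ → List (Cmd Γ) × Stacks Γ
  | ([], s) => ([], s)
  | (skip :: r, s) => (r, s)
  | (push k a :: r, s) => (r, Function.update s k (a :: s k))
  | (pop k f :: r, s) => (f (s k).head? :: r, Function.update s k (s k).tail)
  | (seq c d :: r, s) => (c :: d :: r, s)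
  | (loop k finish f :: r, s) =>
      (if finish (s k).head? then r else f (s k).head? :: loop k finish f :: r,
        Function.update s k (s k).tail)

/-- `c` started in `s` ends in `s'` after at most `t` steps. -/
def Runs (c : Cmd Γ) (s s' : Stacks Γ) (t : ℕ) : Prop :=
  ∀ r, ∃ n ≤ t, step^[n] (c :: r, s) = (r, s')

theorem Runs.mono {c : Cmd Γ} {s s' : Stacks Γ} {t t' : ℕ} (h : Runs c s s' t) (ht : t ≤ t') :
    Runs c s s' t' := fun r =>
  let ⟨n, hn, e⟩ := h r
  ⟨n, hn.trans ht, e⟩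

theorem Runs.skip (s : Stacks Γ) : Runs skip s s 1 := fun _ => ⟨1, le_rfl, rfl⟩

theorem Runs.push (s : Stacks Γ) (k : K) (a : Γ k) :
    Runs (push k a) s (Function.update s k (a :: s k)) 1 := fun _ => ⟨1, le_rfl, rfl⟩

/-- `Runs` allows any continuation, so `c` can be run with `d` waiting behind it; the additional
step unfolds the `seq`. -/
theorem Runs.seq {c d : Cmd Γ} {s s' s'' : Stacks Γ} {t t' : ℕ} (hc : Runs c s s' t)
    (hd : Runs d s' s'' t') : Runs (seq c d) s s'' (t + t' + 1) := fun r => by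
  obtain ⟨n, hn, e⟩ := hc (d :: r)
  obtain ⟨m, hm, e'⟩ := hd r
  refine ⟨m + n + 1, by omega, ?_⟩
  rw [Function.iterate_succ_apply, Function.iterate_add_apply]
  exact (congrArg _ e).trans e'

theorem Runs.pop {k : K} {f : Option (Γ k) → Cmd Γ} {s s' : Stacks Γ} {t : ℕ}
    (h : Runs (f (s k).head?) (Function.update s k (s k).tail) s' t) :
    Runs (pop k f) s s' (t + 1) := fun r => by
  obtain ⟨n, hn, e⟩ := h r
  exact ⟨n + 1, by omega, e⟩

theorem Runs.loop_stop {k : K} {finish : Option (Γ k) → Bool} {f : Option (Γ k) → Cmd Γ}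
    {s : Stacks Γ} (h : finish (s k).head? = true) :
    Runs (loop k finish f) s (Function.update s k (s k).tail) 1 := fun r =>
  ⟨1, le_rfl, by simp [Cmd.step, h]⟩

theorem Runs.loop_step {k : K} {finish : Option (Γ k) → Bool} {f : Option (Γ k) → Cmd Γ}
    {s s' s'' : Stacks Γ} {t t' : ℕ} (h : finish (s k).head? = false)
    (hf : Runs (f (s k).head?) (Function.update s k (s k).tail) s' t)
    (hl : Runs (loop k finish f) s' s'' t') : Runs (loop k finish f) s s'' (t + t' + 1) := fun r => by
  obtain ⟨n, hn, e⟩ := hf (Cmd.loop k finish f :: r)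
  obtain ⟨m, hm, e'⟩ := hl r
  refine ⟨m + n + 1, by omega, ?_⟩
  rw [Function.iterate_succ_apply, Function.iterate_add_apply]
  have : step (Cmd.loop k finish f :: r, s) =
      (f (s k).head? :: Cmd.loop k finish f :: r, Function.update s k (s k).tail) := by
    simp [Cmd.step, h]
  rw [this, e, e']

end Semantics

/-! ### Simulation of stack programs by a Turing machine -/

section Machine

open Turing

variable (P : Cmd Γ)

/-- The alphabets of the machine for `P`: a control stack of subprograms and the stacks of `P`. -/
abbrev Alphabet : Option K → Type
  | none => subs P
  | some k => Γ k

/-- The statements of the machine for `P`. The labels are `none`, where it starts, `some none`,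
where it takes the next program off the control stack, and one label for each subprogram. -/
def stmt : Option (Option (subs P)) → TM2.Stmt (Alphabet P) (Option (Option (subs P)))
    (Option (subs P))
  | none => .push none (fun _ => ⟨P, mem_subs_self P⟩) (.goto fun _ => some none)
  | some none => .pop none (fun _ o => o) (.branch Option.isNone .halt (.goto fun v => some v))
  | some (some ⟨skip, _⟩) => .goto fun _ => some none
  | some (some ⟨push k a, _⟩) => .push (some k) (fun _ => a) (.goto fun _ => some none)
  | some (some ⟨pop k f, h⟩) =>
      .pop (some k) (fun _ o => some ⟨f o, subs_subset h (.inr (Set.mem_iUnion.2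
          ⟨o, mem_subs_self _⟩))⟩)
        (.push none (fun v => v.getD ⟨P, mem_subs_self P⟩) (.goto fun _ => some none))
  | some (some ⟨seq c d, h⟩) =>
      .push none (fun _ => ⟨d, subs_subset h (.inr (.inr (mem_subs_self _)))⟩)
        (.push none (fun _ => ⟨c, subs_subset h (.inr (.inl (mem_subs_self _)))⟩)
          (.goto fun _ => some none))
  | some (some ⟨loop k finish f, h⟩) =>
      .pop (some k) (fun _ o => if finish o then none else some ⟨f o, subs_subset h
          (.inr (Set.mem_iUnion.2 ⟨o, mem_subs_self _⟩))⟩)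
        (.branch Option.isSome
          (.push none (fun _ => ⟨loop k finish f, h⟩)
            (.push none (fun v => v.getD ⟨P, mem_subs_self P⟩) (.goto fun _ => some none)))
          (.goto fun _ => some none))

/-- The stacks of the machine: the control stack and the stacks of the program. -/
def join (r : List (subs P)) (s : Stacks Γ) : ∀ k, List (Alphabet P k)
  | none => r
  | some k => s k

variable {P}

theorem join_none (r : List (subs P)) (s : Stacks Γ) : join P r s none = r := rfl

theorem join_some (r : List (subs P)) (s : Stacks Γ) (k : K) : join P r s (some k) = s k := rfl

variable [DecidableEq K]

theorem update_join_none (r r' : List (subs P)) (s : Stacks Γ) :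
    Function.update (join P r s) none r' = join P r' s := by
  funext k
  cases k <;> simp [join]

theorem update_join_some (r : List (subs P)) (s : Stacks Γ) (k : K) (l : List (Γ k)) :
    Function.update (join P r s) (some k) l = join P r (Function.update s k l) := by
  funext k'
  cases k' with
  | none => simp [join]
  | some k' =>
    by_cases h : k' = k
    · subst h; simp [join]
    · simp [join, h]

/-- One program step costs two machine steps: the label `some none` pops a program off the control
stack, and the label of that program carries it out. -/
theorem step_simulation (c : subs P) (r : List (subs P)) (s : Stacks Γ) (v : Option (subs P)) :
    ∃ r' v', ((TM2.step (stmt P) ⟨some (some none), v, join P (c :: r) s⟩).bind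
        (TM2.step (stmt P))) =
          some ⟨some (some none), v', join P r' (step (c.1 :: r.map Subtype.val, s)).2⟩ ∧
      r'.map Subtype.val = (step (c.1 :: r.map Subtype.val, s)).1 := by
  obtain ⟨c, hc⟩ := c
  have e : TM2.step (stmt P) ⟨some (some none), v, join P (⟨c, hc⟩ :: r) s⟩ =
      some ⟨some (some (some ⟨c, hc⟩)), some ⟨c, hc⟩, join P r s⟩ := by
    simp [stmt, join_none, update_join_none]
  rw [e]
  cases c with
  | skip => exact ⟨r, _, rfl, rfl⟩
  | push k a =>
    refine ⟨r, some ⟨push k a, hc⟩, ?_, rfl⟩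
    simp [stmt, join_some, update_join_some, step]
  | pop k f =>
    refine ⟨⟨f (s k).head?, subs_subset hc (.inr (Set.mem_iUnion.2 ⟨_, mem_subs_self _⟩))⟩ :: r,
      some ⟨f (s k).head?, subs_subset hc (.inr (Set.mem_iUnion.2 ⟨_, mem_subs_self _⟩))⟩,
      ?_, rfl⟩
    simp [stmt, join_some, update_join_some, join_none, update_join_none, step]
  | seq c d =>
    refine ⟨⟨c, subs_subset hc (.inr (.inl (mem_subs_self _)))⟩ ::
      ⟨d, subs_subset hc (.inr (.inr (mem_subs_self _)))⟩ :: r,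
      some ⟨seq c d, hc⟩, ?_, rfl⟩
    simp [stmt, join_none, update_join_none, step]
  | loop k finish f =>
    by_cases h : finish (s k).head? = true
    · refine ⟨r, none, ?_, by simp [step, h]⟩
      simp [stmt, join_some, update_join_some, step, h]
    · refine ⟨⟨f (s k).head?, subs_subset hc (.inr (Set.mem_iUnion.2 ⟨_, mem_subs_self _⟩))⟩ ::
        ⟨loop k finish f, hc⟩ :: r, some ⟨f (s k).head?, subs_subset hc
          (.inr (Set.mem_iUnion.2 ⟨_, mem_subs_self _⟩))⟩, ?_, by simp [step, h]⟩
      simp [stmt, join_some, update_join_some, join_none, update_join_none, step, h]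

theorem run_simulation (n : ℕ) (r : List (subs P)) (s s' : Stacks Γ) (v : Option (subs P))
    (h : step^[n] (r.map Subtype.val, s) = ([], s')) :
    ∃ m ≤ 2 * n + 1, (flip bind (TM2.step (stmt P)))^[m]
      (some ⟨some (some none), v, join P r s⟩) = some ⟨none, none, join P [] s'⟩ := by
  induction n generalizing r s v with
  | zero =>
    simp only [Function.iterate_zero, id_eq, Prod.mk.injEq, List.map_eq_nil_iff] at h
    obtain ⟨rfl, rfl⟩ := h
    -- With an empty control stack the machine halts in one step, which is the summand 1 of the
    -- bound.
    refine ⟨1, by omega, ?_⟩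
    simp [flip, stmt, join_none, update_join_none]
  | succ n ih =>
    cases r with
    | nil =>
      obtain ⟨m, hm, e⟩ := ih [] s v (by simpa [step] using h)
      exact ⟨m, by omega, e⟩
    | cons c r =>
      obtain ⟨r', v', e, e'⟩ := step_simulation c r s v
      rw [Function.iterate_succ_apply] at h
      obtain ⟨m, hm, e''⟩ := ih r' _ v' (by rw [e']; exact h)
      refine ⟨m + 2, by omega, ?_⟩
      rw [Function.iterate_add_apply, ← e'']
      congr 1

/-- A machine that runs the program `P`. -/
noncomputable def machine (P : Cmd Γ) [Fintype K] [∀ k, Fintype (Γ k)] (i o : K) : FinTM2 :=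
  haveI : Fintype (subs P) := (subs_finite P).fintype
  haveI : Fintype (Alphabet P (some i)) := inferInstanceAs (Fintype (Γ i))
  { K := Option K
    k₀ := some i
    k₁ := some o
    Γ := Alphabet P
    Λ := Option (Option (subs P))
    main := none
    σ := Option (subs P)
    initialState := none
    m := stmt P }

theorem initList_machine (P : Cmd Γ) [Fintype K] [∀ k, Fintype (Γ k)] (i o : K)
    (l : List (Γ i)) : initList (machine P i o) l =
      ⟨some none, none, join P [] (Function.update (fun _ => []) i l)⟩ := by
  unfold initList
  congr 1
  funext k
  change Option K at k
  cases k with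
  | none => exact dif_neg nofun
  | some k =>
    by_cases h : k = i
    · subst h
      exact (dif_pos rfl).trans (by simp [join_some]; rfl)
    · refine (dif_neg fun e => h (Option.some.inj e)).trans ?_
      simp [join_some, h]
      rfl

theorem haltList_machine (P : Cmd Γ) [Fintype K] [∀ k, Fintype (Γ k)] (i o : K)
    (l : List (Γ o)) : haltList (machine P i o) l =
      ⟨none, none, join P [] (Function.update (fun _ => []) o l)⟩ := by
  unfold haltList
  congr 1
  funext k
  change Option K at k
  cases k with
  | none => exact dif_neg nofun
  | some k =>
    by_cases h : k = o
    · subst h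
      exact (dif_pos rfl).trans (by simp [join_some]; rfl)
    · refine (dif_neg fun e => h (Option.some.inj e)).trans ?_
      simp [join_some, h]
      rfl

/-- A function computed by a program is computed by a Turing machine, with the same time bound up
to a factor of two. -/
theorem exists_computableInTime (P : Cmd Γ) [Fintype K] [∀ k, Fintype (Γ k)] (i o : K)
    {α β αΓ βΓ : Type} (ea : α → List αΓ) (eb : β → List βΓ) (f : α → β) (ei : Γ i ≃ αΓ)
    (eo : Γ o ≃ βΓ) (T : ℕ → ℕ)
    (h : ∀ a, Runs P (Function.update (fun _ => []) i ((ea a).map ei.symm))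
      (Function.update (fun _ => []) o ((eb (f a)).map eo.symm)) (T (ea a).length)) :
    ∃ M : TM2ComputableInTime ea eb f, M.time = fun n => 2 * T n + 2 := by
  have key : ∀ a, ∃ m ≤ 2 * T (ea a).length + 2,
      (flip bind (machine P i o).step)^[m]
        (some (initList (machine P i o) ((ea a).map ei.symm))) =
      some (haltList (machine P i o) ((eb (f a)).map eo.symm)) := by
    intro a
    obtain ⟨n, hn, e⟩ := h a []
    obtain ⟨m, hm, e'⟩ := run_simulation n [⟨P, mem_subs_self P⟩] _ _ none e
    -- The additional step is the first one, which puts `P` on the control stack.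
    refine ⟨m + 1, by omega, ?_⟩
    have hi := initList_machine P i o ((ea a).map ei.symm)
    have ho := haltList_machine P i o ((eb (f a)).map eo.symm)
    refine (congrArg (fun c => (flip bind (machine P i o).step)^[m + 1] (some c)) hi).trans
      (Eq.trans ?_ (congrArg some ho).symm)
    refine Eq.trans ?_ e'
    rw [Function.iterate_succ_apply]
    refine congrArg ((flip bind (TM2.step (stmt P)))^[m]) ?_
    change TM2.step (stmt P) ⟨some none, none, join P [] _⟩ =
      some ⟨some (some none), none, join P [⟨P, mem_subs_self P⟩] _⟩
    simp [stmt, join_none, update_join_none]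
  choose m hm e using key
  exact ⟨{
    tm := machine P i o
    inputAlphabet := ei
    outputAlphabet := eo
    time := fun n => 2 * T n + 2
    outputsFun := fun a => ⟨⟨m a, e a⟩, hm a⟩ }, rfl⟩

end Machine

end Cmd

/-! ### A functional language on binary trees with explicit costs -/

/-- Binary trees, the data of the programming language `Code`. -/
inductive SExp
  | nil : SExp
  | cons (a b : SExp) : SExp

namespace SExp

/-- A tree in prefix notation. -/
def ser : SExp → List Bool
  | nil => [false]
  | cons a b => true :: (a.ser ++ b.ser)

/-- The number of nodes, leaves included. -/
def size : SExp → ℕ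
  | nil => 1
  | cons a b => a.size + b.size + 1

theorem length_ser (x : SExp) : x.ser.length = x.size := by
  induction x with
  | nil => rfl
  | cons a b iha ihb => simp [ser, size, iha, ihb]

theorem size_pos (x : SExp) : 0 < x.size := by
  cases x <;> simp [size]

end SExp

/-- A language of functions on trees. `fold g` maps `cons l z` to the result of folding `g` over
the spine of `l`, starting with `z`. -/
inductive Code
  | id : Code
  | nil : Code
  | cons (f g : Code) : Code
  | hd : Code
  | tl : Code
  | comp (f g : Code) : Code
  | ite (c f g : Code) : Code
  | fold (g : Code) : Code

namespace Code

open SExp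

/-- Fold of `g` over the spine of a tree. -/
def foldSpine (g : SExp → SExp) : SExp → SExp → SExp
  | .nil, z => z
  | .cons a l, z => foldSpine g l (g (.cons a z))

/-- The function a code stands for. -/
def eval : Code → SExp → SExp
  | id, x => x
  | nil, _ => .nil
  | cons f g, x => .cons (f.eval x) (g.eval x)
  | hd, .nil => .nil
  | hd, .cons a _ => a
  | tl, .nil => .nil
  | tl, .cons _ b => b
  | comp f g, x => f.eval (g.eval x)
  | ite c f g, x =>
    match c.eval x with
    | .nil => g.eval x
    | .cons _ _ => f.eval x
  | fold _, .nil => .nil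
  | fold g, .cons l z => foldSpine g.eval l z

/-- The cost of a fold of a function `g` with cost `t`. -/
def foldCost (g : SExp → SExp) (t : SExp → ℕ) : SExp → SExp → ℕ
  | .nil, _ => 10
  | .cons a l, z => foldCost g t l (g (.cons a z)) + t (.cons a z) + 100 * (a.size + l.size)

/-- A bound for the running time of a code. -/
def cost : Code → SExp → ℕ
  | id, _ => 1
  | nil, x => 10 * x.size + 10
  | cons f g, x => f.cost x + g.cost x + 100 * (x.size + (g.eval x).size)
  | hd, x => 100 * x.size
  | tl, x => 100 * x.size
  | comp f g, x => f.cost (g.eval x) + g.cost x + 1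
  | ite c f g, x =>
    c.cost x + 100 * (x.size + (c.eval x).size) +
      match c.eval x with
      | .nil => g.cost x
      | .cons _ _ => f.cost x
  | fold _, .nil => 10
  | fold g, .cons l z => foldCost g.eval g.cost l z + 10

/-! ### Compilation of the tree language to stack programs -/

/-- The stacks on which codes are executed. -/
inductive Reg
  | inp | out | main | save | aux | count

instance : DecidableEq Reg := fun a b => by
  cases a <;> cases b <;> first | exact isTrue rfl | exact isFalse nofun

instance : Fintype Reg where
  elems := {Reg.inp, Reg.out, Reg.main, Reg.save, Reg.aux, Reg.count}
  complete a := by cases a <;> simp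

/-- The alphabets of the stacks; `none` marks the bottom of a saved tree. -/
abbrev Alph : Reg → Type
  | .inp => InSymbol
  | .out => Bool
  | .main => Bool
  | .save => Option Bool
  | .aux => Option Bool
  | .count => Unit

/-- The stacks with given contents. -/
def stk (i : List InSymbol) (o m : List Bool) (s b : List (Option Bool)) (c : List Unit) :
    Cmd.Stacks Alph
  | .inp => i
  | .out => o
  | .main => m
  | .save => s
  | .aux => b
  | .count => c

section

variable (i : List InSymbol) (o m : List Bool) (s b : List (Option Bool)) (c : List Unit)

@[simp] theorem stk_inp : stk i o m s b c .inp = i := rfl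
@[simp] theorem stk_out : stk i o m s b c .out = o := rfl
@[simp] theorem stk_main : stk i o m s b c .main = m := rfl
@[simp] theorem stk_save : stk i o m s b c .save = s := rfl
@[simp] theorem stk_aux : stk i o m s b c .aux = b := rfl
@[simp] theorem stk_count : stk i o m s b c .count = c := rfl

@[simp] theorem update_inp (l : List InSymbol) :
    Function.update (stk i o m s b c) .inp l = stk l o m s b c := by
  funext k; cases k <;> simp
@[simp] theorem update_out (l : List Bool) :
    Function.update (stk i o m s b c) .out l = stk i l m s b c := by
  funext k; cases k <;> simp
@[simp] theorem update_main (l : List Bool) :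
    Function.update (stk i o m s b c) .main l = stk i o l s b c := by
  funext k; cases k <;> simp
@[simp] theorem update_save (l : List (Option Bool)) :
    Function.update (stk i o m s b c) .save l = stk i o m l b c := by
  funext k; cases k <;> simp
@[simp] theorem update_aux (l : List (Option Bool)) :
    Function.update (stk i o m s b c) .aux l = stk i o m s l c := by
  funext k; cases k <;> simp
@[simp] theorem update_count (l : List Unit) :
    Function.update (stk i o m s b c) .count l = stk i o m s b l := by
  funext k; cases k <;> simp

end

open Cmd

/-- Push a symbol onto the main stack. -/
abbrev pushMain (x : Bool) : Cmd Alph := .push .main x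

/-- Pop as many trees off the main stack as there are symbols on `count`, executing `act` for each
symbol. -/
def scan (act : Bool → Cmd Alph) : Cmd Alph :=
  .loop .count Option.isNone fun _ => .pop .main fun
    | some true => .seq (act true) (.seq (.push .count ()) (.push .count ()))
    | some false => act false
    | none => .skip

/-- Remove a tree from the main stack. -/
def drop : Cmd Alph := .seq (.push .count ()) (scan fun _ => .skip)

/-- Move a tree from the main stack to `save`. -/
def toSave : Cmd Alph :=
  .seq (.push .save none) (.seq (.push .count ()) (scan fun x => .push .save (some x)))

/-- Move a tree from the main stack to `aux`. -/
def toAux : Cmd Alph :=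
  .seq (.push .aux none) (.seq (.push .count ()) (scan fun x => .push .aux (some x)))

/-- Execute `act` for all symbols of the tree saved last on `k`, removing it. -/
def drainSave (act : Bool → Cmd Alph) : Cmd Alph :=
  .loop .save (fun x => x.join.isNone) fun
    | some (some x) => act x
    | _ => .skip

/-- Execute `act` for all symbols of the tree last put on `aux`, removing it. -/
def drainAux (act : Bool → Cmd Alph) : Cmd Alph :=
  .loop .aux (fun x => x.join.isNone) fun
    | some (some x) => act x
    | _ => .skip

/-- Exchange the two topmost trees. -/
def swap : Cmd Alph :=
  .seq toSave (.seq toAux (.seq (drainSave pushMain) (drainAux pushMain)))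

/-- Duplicate the topmost tree. -/
def dup : Cmd Alph :=
  .seq toSave (.seq (.push .aux none)
    (.seq (drainSave fun x => .seq (pushMain x) (.push .aux (some x)))
      (.seq (.push .save none) (.seq (drainAux fun x => .push .save (some x))
        (drainSave pushMain)))))

/-- The program for a code, which replaces the topmost tree by its image. -/
def compile : Code → Cmd Alph
  | id => .skip
  | nil => .seq drop (pushMain false)
  | cons f g => .seq dup (.seq g.compile (.seq swap (.seq f.compile (pushMain true))))
  | hd => .pop .main fun
    | some true => .seq swap drop
    | _ => pushMain false
  | tl => .pop .main fun
    | some true => drop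
    | _ => pushMain false
  | comp f g => .seq g.compile f.compile
  | ite c f g => .seq dup (.seq c.compile (.pop .main fun
    | some true => .seq (.seq drop drop) f.compile
    | _ => g.compile))
  | fold g => .pop .main fun
    | some true => .loop .main (fun x => x != some true) fun _ =>
      .seq swap (.seq toSave (.seq (pushMain true) (.seq g.compile (drainSave pushMain))))
    | _ => pushMain false

section

variable (i : List InSymbol) (o m : List Bool) (s b : List (Option Bool)) (c : List Unit)

theorem runs_push_main (x : Bool) :
    Runs (pushMain x) (stk i o m s b c) (stk i o (x :: m) s b c) 1 := by
  simpa using Runs.push (stk i o m s b c) .main x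

theorem runs_push_save (x : Option Bool) :
    Runs (.push .save x) (stk i o m s b c) (stk i o m (x :: s) b c) 1 := by
  simpa using Runs.push (stk i o m s b c) .save x

theorem runs_push_aux (x : Option Bool) :
    Runs (.push .aux x) (stk i o m s b c) (stk i o m s (x :: b) c) 1 := by
  simpa using Runs.push (stk i o m s b c) .aux x

theorem runs_push_count :
    Runs (.push .count ()) (stk i o m s b c) (stk i o m s b (() :: c)) 1 := by
  simpa using Runs.push (stk i o m s b c) .count ()

theorem runs_push_out (x : Bool) :
    Runs (.push .out x) (stk i o m s b c) (stk i (x :: o) m s b c) 1 := by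
  simpa using Runs.push (stk i o m s b c) .out x

theorem runs_pop_main {f : Option Bool → Cmd Alph} {s' : Stacks Alph} {t : ℕ} (x : Bool)
    (h : Runs (f (some x)) (stk i o m s b c) s' t) :
    Runs (.pop .main f) (stk i o (x :: m) s b c) s' (t + 1) :=
  Runs.pop (by simpa using h)

end

variable {i : List InSymbol} {o : List Bool}

/-- The effect of scanning one tree, where `side w` are the saving stacks after the symbols `w`
have been processed, the last one first. -/
theorem runs_scan_tree {act : Bool → Cmd Alph}
    {side : List Bool → List (Option Bool) × List (Option Bool)}
    (hact : ∀ x w m c, Runs (act x) (stk i o m (side w).1 (side w).2 c)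
      (stk i o m (side (x :: w)).1 (side (x :: w)).2 c) 1) (x : SExp) :
    ∀ (w m : List Bool) (c : List Unit) (s' : Stacks Alph) (t : ℕ),
      Runs (scan act) (stk i o m (side (x.ser.reverse ++ w)).1 (side (x.ser.reverse ++ w)).2 c)
        s' t →
      Runs (scan act) (stk i o (x.ser ++ m) (side w).1 (side w).2 (() :: c)) s'
        (t + 7 * x.size) := by
  induction x with
  | nil =>
    intro w m c s' t h
    refine Runs.mono (Runs.loop_step (t := 2) rfl ?_ h) (by simp [SExp.size]; omega)
    simp only [stk_count, List.tail_cons, update_count, ser]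
    exact runs_pop_main _ _ _ _ _ _ _ (hact _ _ _ _)
  | cons x y ihx ihy =>
    intro w m c s' t h
    -- The counter symbol of the whole tree has been replaced by two, one for each subtree, so the
    -- scan passes through `x` and then `y`.
    have h2 := ihx (true :: w) (y.ser ++ m) (() :: c) s' _
      (ihy (x.ser.reverse ++ true :: w) m c s' t (by simpa [ser] using h))
    refine Runs.mono (Runs.loop_step (t := 6) rfl ?_ h2) (by simp [SExp.size]; omega)
    simp only [stk_count, List.tail_cons, update_count, ser, List.cons_append,
      List.append_assoc]
    exact runs_pop_main _ _ _ _ _ _ _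
      ((hact _ _ _ _).seq ((runs_push_count _ _ _ _ _ _).seq (runs_push_count _ _ _ _ _ _)))

theorem runs_scan_end (act : Bool → Cmd Alph) (m : List Bool) (s b : List (Option Bool)) :
    Runs (scan act) (stk i o m s b []) (stk i o m s b []) 1 := by
  have : Runs (scan act) (stk i o m s b []) _ 1 := Runs.loop_stop rfl
  simpa using this

theorem runs_drop (x : SExp) (m : List Bool) (s b : List (Option Bool)) :
    Runs drop (stk i o (x.ser ++ m) s b []) (stk i o m s b []) (7 * x.size + 3) := by
  have h := runs_scan_tree (i := i) (o := o) (act := fun _ => .skip) (side := fun _ => (s, b))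
    (fun _ _ _ _ => Runs.skip _) x [] m [] _ _ (runs_scan_end _ m s b)
  exact ((runs_push_count _ _ _ _ _ _).seq h).mono (by omega)

theorem runs_toSave (x : SExp) (m : List Bool) (s b : List (Option Bool)) :
    Runs toSave (stk i o (x.ser ++ m) s b [])
      (stk i o m (x.ser.reverse.map some ++ none :: s) b []) (7 * x.size + 5) := by
  have h := runs_scan_tree (i := i) (o := o) (act := fun x => .push .save (some x))
    (side := fun w => (w.map some ++ none :: s, b))
    (fun _ _ _ _ => runs_push_save _ _ _ _ _ _ _) x [] m [] _ _ (runs_scan_end _ m _ b)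
  refine ((runs_push_save _ _ _ _ _ _ _).seq ((runs_push_count _ _ _ _ _ _).seq
    (Runs.mono ?_ le_rfl))).mono (t := 1 + (1 + (1 + 7 * x.size) + 1) + 1) (by omega)
  simpa using h

theorem runs_toAux (x : SExp) (m : List Bool) (s b : List (Option Bool)) :
    Runs toAux (stk i o (x.ser ++ m) s b [])
      (stk i o m s (x.ser.reverse.map some ++ none :: b) []) (7 * x.size + 5) := by
  have h := runs_scan_tree (i := i) (o := o) (act := fun x => .push .aux (some x))
    (side := fun w => (s, w.map some ++ none :: b))
    (fun _ _ _ _ => runs_push_aux _ _ _ _ _ _ _) x [] m [] _ _ (runs_scan_end _ m s _)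
  refine ((runs_push_aux _ _ _ _ _ _ _).seq ((runs_push_count _ _ _ _ _ _).seq
    (Runs.mono ?_ le_rfl))).mono (t := 1 + (1 + (1 + 7 * x.size) + 1) + 1) (by omega)
  simpa using h

/-- The bound 3 for `act` leaves room for two pushes in sequence, as needed in `dup`. -/
theorem runs_drainSave {act : Bool → Cmd Alph} {s : List (Option Bool)} {c : List Unit}
    {side : List Bool → List Bool × List (Option Bool)}
    (hact : ∀ x w s, Runs (act x) (stk i o (side w).1 s (side w).2 c)
      (stk i o (side (x :: w)).1 s (side (x :: w)).2 c) 3) (w : List Bool) :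
    ∀ v, Runs (drainSave act) (stk i o (side v).1 (w.map some ++ none :: s) (side v).2 c)
      (stk i o (side (w.reverse ++ v)).1 s (side (w.reverse ++ v)).2 c) (4 * w.length + 1) := by
  induction w with
  | nil =>
    intro v
    have : Runs (drainSave act) (stk i o (side v).1 (none :: s) (side v).2 c) _ 1 := Runs.loop_stop rfl
    simpa using this
  | cons x w ih =>
    intro v
    refine Runs.mono (t := 3 + (4 * w.length + 1) + 1) ?_ (by simp; omega)
    have h := ih (x :: v)
    simp only [List.reverse_cons, List.append_assoc, List.singleton_append]
    refine Runs.loop_step rfl ?_ h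
    simpa using hact x v _

theorem runs_drainAux {act : Bool → Cmd Alph} {b : List (Option Bool)} {c : List Unit}
    {side : List Bool → List Bool × List (Option Bool)}
    (hact : ∀ x w b, Runs (act x) (stk i o (side w).1 (side w).2 b c)
      (stk i o (side (x :: w)).1 (side (x :: w)).2 b c) 3) (w : List Bool) :
    ∀ v, Runs (drainAux act) (stk i o (side v).1 (side v).2 (w.map some ++ none :: b) c)
      (stk i o (side (w.reverse ++ v)).1 (side (w.reverse ++ v)).2 b c) (4 * w.length + 1) := by
  induction w with
  | nil =>
    intro v
    have : Runs (drainAux act) (stk i o (side v).1 (side v).2 (none :: b) c) _ 1 := Runs.loop_stop rfl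
    simpa using this
  | cons x w ih =>
    intro v
    refine Runs.mono (t := 3 + (4 * w.length + 1) + 1) ?_ (by simp; omega)
    have h := ih (x :: v)
    simp only [List.reverse_cons, List.append_assoc, List.singleton_append]
    refine Runs.loop_step rfl ?_ h
    simpa using hact x v _

/-- Saving reverses the word of the tree and draining reverses it again. -/
theorem runs_restore (x : SExp) (m : List Bool) (s b : List (Option Bool)) (c : List Unit) :
    Runs (drainSave pushMain) (stk i o m (x.ser.reverse.map some ++ none :: s) b c)
      (stk i o (x.ser ++ m) s b c) (4 * x.size + 1) := by
  have h := runs_drainSave (i := i) (o := o) (s := s) (c := c) (act := pushMain)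
    (side := fun w => (w ++ m, b)) (fun _ _ _ => (runs_push_main _ _ _ _ _ _ _).mono (by omega))
    x.ser.reverse []
  simpa [length_ser] using h

theorem runs_restoreAux (x : SExp) (m : List Bool) (s b : List (Option Bool)) (c : List Unit) :
    Runs (drainAux pushMain) (stk i o m s (x.ser.reverse.map some ++ none :: b) c)
      (stk i o (x.ser ++ m) s b c) (4 * x.size + 1) := by
  have h := runs_drainAux (i := i) (o := o) (b := b) (c := c) (act := pushMain)
    (side := fun w => (w ++ m, s)) (fun _ _ _ => (runs_push_main _ _ _ _ _ _ _).mono (by omega))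
    x.ser.reverse []
  simpa [length_ser] using h

theorem runs_swap (x y : SExp) (m : List Bool) (s b : List (Option Bool)) :
    Runs swap (stk i o (x.ser ++ (y.ser ++ m)) s b []) (stk i o (y.ser ++ (x.ser ++ m)) s b [])
      (20 * (x.size + y.size)) := by
  have := x.size_pos
  have := y.size_pos
  exact ((runs_toSave x _ s b).seq ((runs_toAux y m _ b).seq ((runs_restore x m s _ []).seq
    (runs_restoreAux y _ s b [])))).mono (by omega)

theorem runs_dup (x : SExp) (m : List Bool) (s b : List (Option Bool)) :
    Runs dup (stk i o (x.ser ++ m) s b []) (stk i o (x.ser ++ (x.ser ++ m)) s b [])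
      (60 * x.size) := by
  have := x.size_pos
  -- The saved word is drained to the main stack and to `aux` at once. The copy on `aux` has the
  -- wrong direction, so it goes through `save` before it is put on the main stack.
  have h1 := runs_drainSave (i := i) (o := o) (s := s) (c := [])
    (act := fun x => .seq (pushMain x) (.push .aux (some x)))
    (side := fun w => (w ++ m, w.map some ++ none :: b))
    (fun _ _ _ => (runs_push_main _ _ _ _ _ _ _).seq (runs_push_aux _ _ _ _ _ _ _))
    x.ser.reverse []
  have h2 := runs_drainAux (i := i) (o := o) (b := b) (c := [])
    (act := fun x => .push .save (some x))
    (side := fun w => (x.ser ++ m, w.map some ++ none :: s))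
    (fun _ _ _ => (runs_push_save _ _ _ _ _ _ _).mono (by omega)) x.ser []
  simp only [List.length_reverse, length_ser, List.reverse_reverse, List.append_nil,
    List.nil_append, List.map_nil] at h1 h2
  have h := (runs_toSave x m s b).seq ((runs_push_aux i o _ _ _ _ none).seq (h1.seq
    ((runs_push_save i o _ _ _ _ none).seq (h2.seq (runs_restore x _ s b [])))))
  exact h.mono (by omega)

/-- Between rounds the rest of the spine lies above the accumulator. Popping the `true` of `cons a
l` leaves `a`, `l`, `z`. With `l` parked on `save`, a pushed `true` turns the adjacent words of `a`
and `z` into the tree `cons a z`, to which `f` is applied before `l` returns. -/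
theorem runs_fold {f : Code} (hf : ∀ x m s b, Runs f.compile (stk i o (x.ser ++ m) s b [])
      (stk i o ((f.eval x).ser ++ m) s b []) (f.cost x)) (l : SExp) :
    ∀ (z : SExp) (m : List Bool) (s b : List (Option Bool)),
      Runs (.loop .main (fun x => x != some true) fun _ => .seq swap (.seq toSave
          (.seq (pushMain true) (.seq f.compile (drainSave pushMain)))))
        (stk i o (l.ser ++ (z.ser ++ m)) s b []) (stk i o ((foldSpine f.eval l z).ser ++ m) s b [])
        (foldCost f.eval f.cost l z) := by
  induction l with
  | nil =>
    intro z m s b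
    refine (Runs.mono (t := 1) ?_ (by simp [foldCost]))
    have := Runs.loop_stop (k := Reg.main) (finish := fun x => x != some true)
      (f := fun _ => .seq swap (.seq toSave
          (.seq (pushMain true) (.seq f.compile (drainSave pushMain)))))
      (s := stk i o (SExp.nil.ser ++ (z.ser ++ m)) s b []) rfl
    simpa [ser, foldSpine] using this
  | cons a l _ ih =>
    intro z m s b
    have := a.size_pos
    have := l.size_pos
    have h0 := hf (.cons a z) m (l.ser.reverse.map some ++ none :: s) b
    simp only [ser, List.cons_append, List.append_assoc] at h0
    have h1 := ((runs_swap a l (z.ser ++ m) s b).seq ((runs_toSave (i := i) (o := o) l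
      (a.ser ++ (z.ser ++ m)) s b).seq ((runs_push_main i o _ _ _ _ true).seq
        (h0.seq (runs_restore l _ s b [])))))
    refine (Runs.loop_step (k := Reg.main) rfl ?_ (ih (f.eval (.cons a z)) m s b)).mono
      (t := (20 * (a.size + l.size) + (7 * l.size + 5 +
        (1 + (f.cost (.cons a z) + (4 * l.size + 1) + 1) + 1) + 1) + 1) +
        foldCost f.eval f.cost l (f.eval (.cons a z)) + 1) (by simp only [foldCost]; omega)
    simpa [ser] using h1

/-- The program for `f` replaces the topmost tree by its image under `f`. -/
theorem runs_compile (f : Code) : ∀ x m s b, Runs f.compile (stk i o (x.ser ++ m) s b [])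
    (stk i o ((f.eval x).ser ++ m) s b []) (f.cost x) := by
  induction f with
  | id =>
    intro x m s b
    exact Runs.skip _
  | nil =>
    intro x m s b
    refine Runs.mono ((runs_drop x m s b).seq (runs_push_main _ _ _ _ _ _ _)) ?_
    simp only [cost]
    omega
  | cons f g ihf ihg =>
    intro x m s b
    have := x.size_pos
    have := (g.eval x).size_pos
    have h := (runs_dup x m s b).seq ((ihg x _ s b).seq ((runs_swap (g.eval x) x m s b).seq
      ((ihf x _ s b).seq (runs_push_main i o _ s b [] true))))
    simp only [eval, ser, List.cons_append, List.append_assoc]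
    exact h.mono (by simp only [cost]; omega)
  | hd =>
    intro x m s b
    cases x with
    | nil =>
      refine Runs.mono (t := 2) (runs_pop_main _ _ _ _ _ _ _ (runs_push_main _ _ _ _ _ _ _)) ?_
      simp [cost, SExp.size]
    | cons x y =>
      simp only [ser, List.cons_append, List.append_assoc]
      refine Runs.mono (t := 20 * (x.size + y.size) + (7 * y.size + 3) + 1 + 1)
        (runs_pop_main _ _ _ _ _ _ _ ((runs_swap x y m s b).seq (runs_drop y _ s b))) ?_
      simp only [cost, SExp.size]
      omega
  | tl =>
    intro x m s b
    cases x with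
    | nil =>
      refine Runs.mono (t := 2) (runs_pop_main _ _ _ _ _ _ _ (runs_push_main _ _ _ _ _ _ _)) ?_
      simp [cost, SExp.size]
    | cons x y =>
      simp only [ser, List.cons_append, List.append_assoc]
      refine Runs.mono (t := 7 * x.size + 3 + 1)
        (runs_pop_main _ _ _ _ _ _ _ (runs_drop x _ s b)) ?_
      simp only [cost, SExp.size]
      omega
  | comp f g ihf ihg =>
    intro x m s b
    exact ((ihg x m s b).seq (ihf _ m s b)).mono (by simp only [cost]; omega)
  | ite c f g ihc ihf ihg =>
    intro x m s b
    have := x.size_pos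
    have h := ihc x (x.ser ++ m) s b
    rcases e : c.eval x with _ | ⟨y, z⟩
    · rw [e] at h
      simp only [eval, e]
      refine Runs.mono (t := 60 * x.size + (c.cost x + (g.cost x + 1) + 1) + 1)
        ((runs_dup x m s b).seq (h.seq (runs_pop_main _ _ _ _ _ _ _ (ihg x m s b)))) ?_
      simp only [cost, e]
      omega
    · rw [e] at h
      have h2 := ((runs_drop (i := i) (o := o) y _ s b).seq (runs_drop z (x.ser ++ m) s b)).seq
        (ihf x m s b)
      simp only [ser, List.cons_append, List.append_assoc] at h
      simp only [eval, e]
      refine Runs.mono (t := 60 * x.size + (c.cost x +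
        ((7 * y.size + 3 + (7 * z.size + 3) + 1 + f.cost x + 1) + 1) + 1) + 1)
        ((runs_dup x m s b).seq (h.seq (runs_pop_main _ _ _ _ _ _ _ h2))) ?_
      simp only [cost, e, SExp.size]
      omega
  | fold f ih =>
    intro x m s b
    cases x with
    | nil =>
      refine Runs.mono (t := 2) (runs_pop_main _ _ _ _ _ _ _ (runs_push_main _ _ _ _ _ _ _)) ?_
      simp [cost]
    | cons l z =>
      simp only [ser, List.cons_append, List.append_assoc]
      refine Runs.mono (t := foldCost f.eval f.cost l z + 1)
        (runs_pop_main _ _ _ _ _ _ _ (runs_fold ih l z m s b)) ?_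
      simp only [cost]
      omega

end Code

/-! ### Reading the input and writing the output -/

namespace SExp

/-- A list of trees as a tree. -/
def ofList : List SExp → SExp
  | [] => nil
  | a :: l => cons a (ofList l)

/-- A truth value as a tree. -/
def ofBool : Bool → SExp
  | false => nil
  | true => cons nil nil

/-- An input symbol as a tree. -/
def ofSymbol : InSymbol → SExp
  | .bit b => cons nil (ofBool b)
  | .comma => cons (ofBool true) (ofBool false)
  | .semicolon => cons (ofBool true) (ofBool true)

theorem size_ofSymbol_le (x : InSymbol) : (ofSymbol x).size ≤ 7 := by
  rcases x with (_ | _) | _ | _ <;> simp [ofSymbol, ofBool, size]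

end SExp

namespace Code

open SExp Cmd

/-- Push a word onto the main stack, its first symbol last. -/
def pushWord : List Bool → Cmd Alph
  | [] => .skip
  | a :: w => .seq (pushWord w) (pushMain a)

/-- Put the list of the input symbols in reversed order on the main stack. -/
def readInput : Cmd Alph :=
  .seq (pushMain false) (.loop .inp Option.isNone fun
    | some x => .seq (pushWord (ofSymbol x).ser) (pushMain true)
    | none => .skip)

/-- Move a list of truth values from the main stack to the output stack, reversing it. -/
def writeOutput : Cmd Alph :=
  .loop .main (fun x => x != some true) fun _ => .pop .main fun
    | some true => .seq (.pop .main fun _ => .skip) (.seq (.pop .main fun _ => .skip)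
        (.push .out true))
    | _ => .push .out false

theorem runs_pushWord (i : List InSymbol) (o m : List Bool) (s b : List (Option Bool))
    (c : List Unit) (w : List Bool) :
    Runs (pushWord w) (stk i o m s b c) (stk i o (w ++ m) s b c) (2 * w.length + 1) := by
  induction w with
  | nil => exact Runs.skip _
  | cons a w ih => exact (ih.seq (runs_push_main i o (w ++ m) s b c a)).mono (by simp; omega)

/-- Every symbol is put in front of the list built so far, so the list comes out reversed. -/
theorem runs_readInput (w : List InSymbol) :
    Runs readInput (stk w [] [] [] [] [])
      (stk [] [] (ofList (w.reverse.map ofSymbol)).ser [] [] []) (18 * w.length + 3) := by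
  have key : ∀ w z : List InSymbol, Runs (.loop .inp Option.isNone fun
      | some x => .seq (pushWord (ofSymbol x).ser) (pushMain true)
      | none => .skip) (stk w [] (ofList (z.map ofSymbol)).ser [] [] [])
      (stk [] [] (ofList ((w.reverse ++ z).map ofSymbol)).ser [] [] []) (18 * w.length + 1) := by
    intro w
    induction w with
    | nil =>
      intro z
      have : Runs (.loop .inp Option.isNone fun
        | some x => .seq (pushWord (ofSymbol x).ser) (pushMain true)
        | none => .skip) (stk [] [] (ofList (z.map ofSymbol)).ser [] [] []) _ 1 :=
        Runs.loop_stop rfl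
      simpa using this
    | cons x w ih =>
      intro z
      have h := (runs_pushWord w [] (ofList (z.map ofSymbol)).ser [] [] [] (ofSymbol x).ser).seq
        (runs_push_main w [] _ [] [] [] true)
      have h' := ih (x :: z)
      simp only [List.reverse_cons, List.append_assoc, List.singleton_append]
      have hs := size_ofSymbol_le x
      rw [length_ser] at h
      -- The tree of a symbol has at most 7 nodes; pushing it and a `true` takes at most `2 * 7 + 3
      -- = 17` steps.
      refine Runs.mono (t := 17 + (18 * w.length + 1) + 1) ?_
        (by simp only [List.length_cons]; omega)
      refine Runs.loop_step rfl ?_ h'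
      refine Runs.mono ?_ (show 2 * (ofSymbol x).size + 1 + 1 + 1 ≤ 17 by omega)
      simpa [ser, ofList] using h
  have h := (runs_push_main w [] [] [] [] [] false).seq (key w [])
  rw [List.append_nil] at h
  exact h.mono (by omega)

theorem runs_writeOutput (l : List Bool) (o : List Bool) :
    Runs writeOutput (stk [] o (ofList (l.map ofBool)).ser [] [] [])
      (stk [] (l.reverse ++ o) [] [] [] []) (9 * l.length + 1) := by
  induction l generalizing o with
  | nil =>
    have : Runs writeOutput (stk [] o [false] [] [] []) _ 1 := Runs.loop_stop rfl
    simpa [ofList, ser] using this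
  | cons x l ih =>
    have h := ih (x :: o)
    simp only [List.reverse_cons, List.append_assoc, List.singleton_append]
    refine Runs.mono (t := 8 + (9 * l.length + 1) + 1) (Runs.loop_step rfl ?_ h)
      (by simp only [List.length_cons]; omega)
    simp only [List.map_cons, ofList, ser, stk_main, List.tail_cons,
      update_main]
    cases x with
    | false =>
      exact (runs_pop_main _ _ _ _ _ _ _ (runs_push_out _ _ _ _ _ _ _)).mono (by omega)
    | true =>
      have hpop : ∀ x m, Runs (.pop .main fun _ => .skip) (stk [] o (x :: m) [] [] [])
          (stk [] o m [] [] []) 2 := fun x m =>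
        runs_pop_main _ _ _ _ _ _ _ (f := fun _ => .skip) (Runs.skip _)
      exact runs_pop_main _ _ _ _ _ _ _ ((hpop _ _).seq ((hpop _ _).seq
        (runs_push_out _ _ _ _ _ _ _)))

instance : Fintype InSymbol where
  elems := ⟨[InSymbol.bit false, .bit true, .comma, .semicolon], by simp⟩
  complete a := by rcases a with (_ | _) | _ | _ <;> simp

instance (k : Reg) : Fintype (Alph k) := by
  cases k
  · exact inferInstanceAs (Fintype InSymbol)
  · exact inferInstanceAs (Fintype Bool)
  · exact inferInstanceAs (Fintype Bool)
  · exact inferInstanceAs (Fintype (Option Bool))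
  · exact inferInstanceAs (Fintype (Option Bool))
  · exact inferInstanceAs (Fintype Unit)

/-- A function computed by a code is computed by a Turing machine, within the time bound of the
code up to a constant factor and the time for input and output. -/
theorem exists_computableInTime {α β : Type} (ea : α → List InSymbol) (eb : β → List Bool)
    (f : α → β) (c : Code) (T : ℕ → ℕ)
    (hc : ∀ a, c.eval (ofList ((ea a).reverse.map ofSymbol)) =
      ofList ((eb (f a)).reverse.map ofBool))
    (ht : ∀ a, c.cost (ofList ((ea a).reverse.map ofSymbol)) ≤ T (ea a).length)
    (hl : ∀ a, (eb (f a)).length ≤ T (ea a).length) :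
    ∃ M : Turing.TM2ComputableInTime ea eb f, M.time = fun n => 20 * T n + 36 * n + 14 := by
  obtain ⟨M, hM⟩ := Cmd.exists_computableInTime (Γ := Alph)
    (.seq readInput (.seq c.compile writeOutput)) .inp .out ea eb f (Equiv.refl InSymbol)
    -- Reading takes 18 steps per symbol, the code takes `T n` steps, and writing takes 9 steps for
    -- each of at most `T n` digits.
    (Equiv.refl Bool) (fun n => 10 * T n + 18 * n + 6) fun a => by
      have h1 := runs_readInput (ea a)
      have h2 := runs_compile (i := []) (o := []) c (ofList ((ea a).reverse.map ofSymbol)) [] [] []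
      have h3 := runs_writeOutput (eb (f a)).reverse []
      rw [hc] at h2
      simp only [List.append_nil, List.reverse_reverse, List.length_reverse] at h2 h3
      have hi : (Function.update (fun _ => []) Reg.inp
          ((ea a).map (Equiv.refl InSymbol).symm) : Stacks Alph) = stk (ea a) [] [] [] [] [] := by
        funext k; cases k <;> simp
      have ho : (Function.update (fun _ => []) Reg.out
          ((eb (f a)).map (Equiv.refl Bool).symm) : Stacks Alph) = stk [] (eb (f a)) [] [] [] [] := by
        funext k; cases k <;> simp
      rw [hi, ho]
      refine (h1.seq (h2.seq h3)).mono ?_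
      have := ht a
      have := hl a
      omega
  exact ⟨M, by rw [hM]; funext n; ring⟩

end Code

/-! ### Functions of polynomial cost relative to a measure -/

/-- Types whose elements are represented by trees. The measure, at least the size of the
representation, is what running times are compared with. -/
class Dat (α : Type) where
  enc : α → SExp
  meas : α → ℕ
  size_enc_le : ∀ a, (enc a).size ≤ meas a

namespace Dat

instance : Dat Unit where
  enc _ := .nil
  meas _ := 1
  size_enc_le _ := le_rfl

/-- The measure is the same for both values, so changing a flag in the state of a fold does not
change the measure of the state. -/
instance : Dat Bool where
  enc := SExp.ofBool
  meas _ := 3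
  size_enc_le b := by cases b <;> simp [SExp.ofBool, SExp.size]

/-- Numbers are unary here and serve as counters and bounds. Binary numerals are values of type
`List Bool`. -/
instance : Dat ℕ where
  enc n := SExp.ofList (List.replicate n .nil)
  meas n := 2 * n + 1
  size_enc_le n := by
    induction n with
    | zero => simp [SExp.ofList, SExp.size]
    | succ n ih => simp only [List.replicate_succ, SExp.ofList, SExp.size] at ih ⊢; omega

variable {α β : Type} [Dat α] [Dat β]

instance : Dat (α × β) where
  enc p := .cons (enc p.1) (enc p.2)
  meas p := meas p.1 + meas p.2 + 1
  size_enc_le p := by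
    have := size_enc_le p.1
    have := size_enc_le p.2
    simp only [SExp.size]
    omega

instance : Dat (List α) where
  enc l := SExp.ofList (l.map enc)
  meas l := (l.map fun a => meas a + 1).sum + 1
  size_enc_le l := by
    induction l with
    | nil => simp [SExp.ofList, SExp.size]
    | cons a l ih =>
      have := size_enc_le a
      simp only [List.map_cons, SExp.ofList, SExp.size, List.sum_cons] at ih ⊢
      omega

theorem enc_pair (a : α) (b : β) : enc (a, b) = .cons (enc a) (enc b) := rfl

theorem meas_pair (a : α) (b : β) : meas (a, b) = meas a + meas b + 1 := rfl

theorem meas_nil : meas ([] : List α) = 1 := rfl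

theorem meas_cons (a : α) (l : List α) : meas (a :: l) = meas a + meas l + 1 := by
  change ((a :: l).map fun a => meas a + 1).sum + 1 = meas a + ((l.map fun a => meas a + 1).sum + 1)
    + 1
  simp only [List.map_cons, List.sum_cons]
  omega

theorem meas_append (l m : List α) : meas (l ++ m) + 1 = meas l + meas m := by
  induction l with
  | nil => simp [meas_nil, add_comm]
  | cons a l ih => simp only [List.cons_append, meas_cons]; omega

theorem meas_bool (b : Bool) : meas b = 3 := rfl

theorem meas_nat (n : ℕ) : meas n = 2 * n + 1 := rfl

theorem meas_le_of_mem {a : α} {l : List α} (h : a ∈ l) : meas a ≤ meas l := by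
  induction l with
  | nil => simp at h
  | cons b l ih =>
    rw [meas_cons]
    rcases List.mem_cons.1 h with rfl | h
    · omega
    · have := ih h; omega

theorem length_le_meas (l : List α) : l.length ≤ meas l := by
  induction l with
  | nil => simp
  | cons b l ih => rw [meas_cons, List.length_cons]; omega

theorem meas_list_le {l : List α} {B : ℕ} (h : ∀ a ∈ l, meas a ≤ B) :
    meas l ≤ l.length * (B + 1) + 1 := by
  induction l with
  | nil => simp [meas_nil]
  | cons b l ih =>
    have h1 := h b (by simp)
    have h2 := ih fun a ha => h a (by simp [ha])
    rw [meas_cons, List.length_cons, Nat.add_mul]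
    omega

end Dat

open Dat

/-- A function that is bounded by a power of the measure. -/
def PolyBdd {α : Type} [Dat α] (g : α → ℕ) : Prop :=
  ∃ k, ∀ a, g a ≤ (meas a + 2) ^ k

namespace PolyBdd

variable {α β : Type} [Dat α] [Dat β] {f g : α → ℕ}

theorem mono (hg : PolyBdd g) (h : ∀ a, f a ≤ g a) : PolyBdd f :=
  let ⟨k, hk⟩ := hg
  ⟨k, fun a => (h a).trans (hk a)⟩

/-- The offset 2 in `PolyBdd` makes the base at least 2, so constants and sums can be absorbed by a
larger exponent. -/
theorem const (n : ℕ) : PolyBdd fun _ : α => n :=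
  ⟨n, fun _ => n.lt_two_pow_self.le.trans (Nat.pow_le_pow_left (by omega) n)⟩

theorem meas_self : PolyBdd fun a : α => meas a :=
  ⟨1, fun a => by rw [pow_one]; exact Nat.le_add_right _ _⟩

theorem mul (hf : PolyBdd f) (hg : PolyBdd g) : PolyBdd fun a => f a * g a :=
  let ⟨j, hj⟩ := hf
  let ⟨k, hk⟩ := hg
  ⟨j + k, fun a => (Nat.mul_le_mul (hj a) (hk a)).trans_eq (pow_add _ _ _).symm⟩

theorem pow (hf : PolyBdd f) (n : ℕ) : PolyBdd fun a => f a ^ n :=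
  let ⟨j, hj⟩ := hf
  ⟨j * n, fun a => (Nat.pow_le_pow_left (hj a) n).trans_eq (pow_mul _ _ _).symm⟩

theorem add (hf : PolyBdd f) (hg : PolyBdd g) : PolyBdd fun a => f a + g a := by
  obtain ⟨j, hj⟩ := hf
  obtain ⟨k, hk⟩ := hg
  refine ⟨max j k + 1, fun a => ?_⟩
  have h1 : (meas a + 2) ^ j ≤ (meas a + 2) ^ max j k :=
    Nat.pow_le_pow_right (by omega) (le_max_left _ _)
  have h2 : (meas a + 2) ^ k ≤ (meas a + 2) ^ max j k :=
    Nat.pow_le_pow_right (by omega) (le_max_right _ _)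
  have h3 : (meas a + 2) ^ max j k * 2 ≤ (meas a + 2) ^ max j k * (meas a + 2) :=
    Nat.mul_le_mul_left _ (by omega)
  have h4 := hj a
  have h5 := hk a
  change f a + g a ≤ _
  rw [pow_succ]
  omega

theorem comp {h : α → β} {g : β → ℕ} (hg : PolyBdd g) (hh : PolyBdd fun a => meas (h a)) :
    PolyBdd fun a => g (h a) :=
  let ⟨k, hk⟩ := hg
  ((hh.add (const 2)).pow k).mono fun a => hk (h a)

end PolyBdd

/-- A function computed by a code in time polynomial in the measure of the argument, the values of
which have a measure polynomial in the measure of the argument. -/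
def PolyTime {α β : Type} [Dat α] [Dat β] (f : α → β) : Prop :=
  ∃ c : Code, (∀ a, c.eval (enc a) = enc (f a)) ∧ (PolyBdd fun a : α => c.cost (enc a)) ∧
    PolyBdd fun a : α => meas (f a)

namespace PolyTime

variable {α β γ δ : Type} [Dat α] [Dat β] [Dat γ] [Dat δ]

theorem meas_bdd {f : α → β} (hf : PolyTime f) : PolyBdd fun a => meas (f a) :=
  hf.choose_spec.2.2

theorem polyBdd_size : PolyBdd fun a : α => (enc a).size :=
  PolyBdd.meas_self.mono size_enc_le

theorem size_bdd {f : α → β} (hf : PolyTime f) : PolyBdd fun a => (enc (f a)).size :=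
  hf.meas_bdd.mono fun a => size_enc_le (f a)

/-- The code only sees trees, so data can be reread as data of another type at no cost. -/
theorem of_enc {f : α → β} {g : α → γ} (hf : PolyTime f) (h : ∀ a, enc (g a) = enc (f a))
    (hm : PolyBdd fun a => meas (g a)) : PolyTime g :=
  let ⟨c, hc, hc', _⟩ := hf
  ⟨c, fun a => (hc a).trans (h a).symm, hc', hm⟩

theorem id : PolyTime fun a : α => a :=
  ⟨.id, fun _ => rfl, PolyBdd.const 1, PolyBdd.meas_self⟩

theorem comp {g : β → γ} {f : α → β} (hg : PolyTime g) (hf : PolyTime f) :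
    PolyTime fun a => g (f a) := by
  obtain ⟨c, hc, hc', hm⟩ := hg
  obtain ⟨d, hd, hd', hm'⟩ := hf
  refine ⟨.comp c d, fun a => by rw [Code.eval, hd, hc], ?_, hm.comp hm'⟩
  refine (((hc'.comp hm').add hd').add (PolyBdd.const 1)).mono fun a => ?_
  rw [Code.cost, hd]

theorem exists_const (s : SExp) : ∃ c : Code, (∀ x, c.eval x = s) ∧
    PolyBdd fun a : α => c.cost (enc a) := by
  induction s with
  | nil =>
    exact ⟨.nil, fun _ => rfl, ((PolyBdd.const 10).mul polyBdd_size).add (PolyBdd.const 10)⟩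
  | cons s t ihs iht =>
    obtain ⟨c, hc, hc'⟩ := ihs
    obtain ⟨d, hd, hd'⟩ := iht
    refine ⟨.cons c d, fun x => by rw [Code.eval, hc, hd], ?_⟩
    refine ((hc'.add hd').add ((PolyBdd.const 100).mul
      (polyBdd_size.add (PolyBdd.const t.size)))).mono fun a => ?_
    rw [Code.cost, hd]

theorem const (b : β) : PolyTime fun _ : α => b :=
  let ⟨c, hc, hc'⟩ := exists_const (α := α) (enc b)
  ⟨c, fun _ => hc _, hc', PolyBdd.const _⟩

theorem pair {f : α → β} {g : α → γ} (hf : PolyTime f) (hg : PolyTime g) :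
    PolyTime fun a => (f a, g a) := by
  have hs := hg.size_bdd
  obtain ⟨c, hc, hc', hm⟩ := hf
  obtain ⟨d, hd, hd', hm'⟩ := hg
  refine ⟨.cons c d, fun a => by rw [Code.eval, hd, hc, enc_pair], ?_,
    (hm.add hm').add (PolyBdd.const 1)⟩
  refine ((hc'.add hd').add ((PolyBdd.const 100).mul (polyBdd_size.add hs))).mono fun a => ?_
  rw [Code.cost, hd]

theorem fst' : PolyTime fun p : α × β => p.1 :=
  ⟨.hd, fun _ => rfl, ((PolyBdd.const 100).mul polyBdd_size).mono fun a => by rw [Code.cost],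
    PolyBdd.meas_self.mono fun p => by
      change meas p.1 ≤ meas p.1 + meas p.2 + 1
      omega⟩

theorem snd' : PolyTime fun p : α × β => p.2 :=
  ⟨.tl, fun _ => rfl, ((PolyBdd.const 100).mul polyBdd_size).mono fun a => by rw [Code.cost],
    PolyBdd.meas_self.mono fun p => by
      change meas p.2 ≤ meas p.1 + meas p.2 + 1
      omega⟩

theorem fst {f : α → β × γ} (hf : PolyTime f) : PolyTime fun a => (f a).1 := fst'.comp hf

theorem snd {f : α → β × γ} (hf : PolyTime f) : PolyTime fun a => (f a).2 := snd'.comp hf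

theorem cond {c : α → Bool} {f g : α → β} (hc : PolyTime c) (hf : PolyTime f) (hg : PolyTime g) :
    PolyTime fun a => cond (c a) (f a) (g a) := by
  have hs := hc.size_bdd
  obtain ⟨c', hc, hc', _⟩ := hc
  obtain ⟨d, hd, hd', hm⟩ := hf
  obtain ⟨e, he, he', hm'⟩ := hg
  refine ⟨.ite c' d e, fun a => ?_, ?_, (hm.add hm').mono fun a => ?_⟩
  · rw [Code.eval, hc, hd, he]
    change _ = enc (bif c a then f a else g a)
    cases c a <;> rfl
  · refine ((hc'.add ((PolyBdd.const 100).mul (polyBdd_size.add hs))).add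
      (hd'.add he')).mono fun a => ?_
    rw [Code.cost, hc]
    refine Nat.add_le_add_left ?_ _
    cases c a
    · exact Nat.le_add_left _ _
    · exact Nat.le_add_right _ _
  · change meas (bif c a then f a else g a) ≤ _
    cases c a
    · exact Nat.le_add_left _ _
    · exact Nat.le_add_right _ _

/-- A code has no free variables, so the parameter `c` of the step function travels along in the
accumulator. -/
theorem foldSpine_eq {g : γ → β → α → β} {s : Code}
    (hs : ∀ (a : α) (c : γ) (b : β), s.eval (enc (a, c, b)) = enc (c, g c b a)) (c : γ) (l : List α) (b : β) :
    Code.foldSpine s.eval (enc l) (enc (c, b)) = enc (c, l.foldl (g c) b) := by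
  induction l generalizing b with
  | nil => rfl
  | cons a l ih => exact (congrArg _ (hs a c b)).trans (ih (g c b a))

/-- Every accumulator is the fold over a prefix of the list. One bound `B` for all prefixes thus
bounds the argument `(a, c, b)` of every call of `s`, and `L + meas c + B + 4` bounds its measure
plus 2. -/
theorem foldCost_le {g : γ → β → α → β} {s : Code} {k : ℕ}
    (hs : ∀ (a : α) (c : γ) (b : β), s.eval (enc (a, c, b)) = enc (c, g c b a))
    (ht : ∀ (a : α) (c : γ) (b : β), s.cost (enc (a, c, b)) ≤ (meas (a, c, b) + 2) ^ k) (c : γ) (L B : ℕ)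
    (l : List α) (b : β) (hl : meas l ≤ L)
    (hB : ∀ m, m <+: l → meas (m.foldl (g c) b) ≤ B) :
    Code.foldCost s.eval s.cost (enc l) (enc (c, b)) ≤
      l.length * ((L + meas c + B + 4) ^ k + 100 * L) + 10 := by
  induction l generalizing b with
  | nil => exact Nat.le_add_left _ _
  | cons a l ih =>
    rw [meas_cons] at hl
    have h := ih (g c b a) (by omega) fun m hm => by
      have := hB (a :: m) (List.cons_prefix_cons.2 ⟨rfl, hm⟩)
      simpa using this
    have h1 : Code.foldCost s.eval s.cost (enc (a :: l)) (enc (c, b)) =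
        Code.foldCost s.eval s.cost (enc l) (enc (c, g c b a)) + s.cost (enc (a, c, b)) +
          100 * ((enc a).size + (enc l).size) := by
      rw [← hs a c b]
      rfl
    have h2 := ht a c b
    have hb : meas b ≤ B := by simpa using hB [] (List.nil_prefix)
    have h3 : (meas (a, c, b) + 2) ^ k ≤ (L + meas c + B + 4) ^ k := by
      refine Nat.pow_le_pow_left ?_ k
      rw [meas_pair, meas_pair]
      omega
    have h4 := size_enc_le a
    have h5 := size_enc_le l
    rw [h1, List.length_cons, Nat.add_mul, one_mul]
    omega

/-- Folds with polynomially bounded intermediate results. -/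
theorem foldl_of_bdd {l : γ → List α} {z : γ → β} {g : γ → β → α → β} (hl : PolyTime l)
    (hz : PolyTime z) (hg : PolyTime fun p : γ × β × α => g p.1 p.2.1 p.2.2) {B : γ → ℕ}
    (hB : PolyBdd B) (h : ∀ c m, m <+: l c → meas (m.foldl (g c) (z c)) ≤ B c) :
    PolyTime fun c => (l c).foldl (g c) (z c) := by
  have hstep : PolyTime fun p : α × γ × β => (p.2.1, g p.2.1 p.2.2 p.1) :=
    (fst (snd id)).pair (hg.comp ((fst (snd id)).pair ((snd (snd id)).pair (fst id))))
  obtain ⟨s, hs, ⟨k, hk⟩, -⟩ := hstep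
  have hs' : ∀ a c b, s.eval (enc (a, c, b)) = enc (c, g c b a) := fun a c b => hs (a, c, b)
  have harg : PolyTime fun c => (l c, c, z c) := hl.pair (id.pair hz)
  have hlm := hl.meas_bdd
  have hargm := harg.meas_bdd
  obtain ⟨d, hd, hd', -⟩ := harg
  have hout : ∀ c, meas ((l c).foldl (g c) (z c)) ≤ B c := fun c => h c _ (List.prefix_refl _)
  have hfold : ∀ c, (Code.fold s).eval (enc (l c, c, z c)) =
      enc (c, (l c).foldl (g c) (z c)) := fun c => foldSpine_eq hs' c (l c) (z c)
  have hcost : PolyBdd fun c => (Code.fold s).cost (enc (l c, c, z c)) := by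
    refine (((hlm.mul ((((hlm.add PolyBdd.meas_self).add hB).add (PolyBdd.const 4)).pow k |>.add
      ((PolyBdd.const 100).mul hlm))).add (PolyBdd.const 10)).add (PolyBdd.const 10)).mono
        fun c => ?_
    have := foldCost_le hs' (fun a c b => hk (a, c, b)) c (meas (l c)) (B c) (l c) (z c) le_rfl
      (h c)
    refine (Nat.add_le_add_right this 10).trans ?_
    exact Nat.add_le_add_right (Nat.add_le_add_right (Nat.mul_le_mul_right _
      (length_le_meas _)) _) _
  -- The fold returns the parameter together with the result; `.tl` discards the parameter.
  refine ⟨.comp .tl (.comp (.fold s) d), fun c => ?_, ?_, hB.mono hout⟩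
  · rw [Code.eval, Code.eval, hd, hfold]
    rfl
  · refine ((((PolyBdd.const 100).mul ((PolyBdd.meas_self.add hB).add (PolyBdd.const 1))).add
      ((hcost.add hd').add (PolyBdd.const 1))).add (PolyBdd.const 1)).mono fun c => ?_
    rw [Code.cost, Code.cost, Code.cost, Code.eval, hd, hfold]
    refine Nat.add_le_add_right (Nat.add_le_add_right (Nat.mul_le_mul_left _ ?_) _) _
    have := size_enc_le (c, (l c).foldl (g c) (z c))
    have := hout c
    rw [meas_pair] at *
    omega

/-- Folds in which every step adds a polynomially bounded amount. -/
theorem foldl {l : γ → List α} {z : γ → β} {g : γ → β → α → β} (hl : PolyTime l)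
    (hz : PolyTime z) (hg : PolyTime fun p : γ × β × α => g p.1 p.2.1 p.2.2) {B : γ → ℕ}
    (hB : PolyBdd B) (h : ∀ c b, ∀ a ∈ l c, meas (g c b a) ≤ meas b + B c) :
    PolyTime fun c => (l c).foldl (g c) (z c) := by
  -- Additive growth gives at most the initial measure plus the number of steps times `B c`; growth
  -- by a factor in each step would not be polynomial.
  refine foldl_of_bdd hl hz hg (hz.meas_bdd.add (hl.meas_bdd.mul hB)) fun c m hm => ?_
  have key : ∀ m : List α, (∀ a ∈ m, a ∈ l c) → ∀ b,
      meas (m.foldl (g c) b) ≤ meas b + m.length * B c := by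
    intro m
    induction m with
    | nil => intro _ b; simp
    | cons a m ih =>
      intro hm b
      have h1 := ih (fun x hx => hm x (by simp [hx])) (g c b a)
      have h2 := h c b a (hm a (by simp))
      rw [List.foldl_cons, List.length_cons, Nat.add_mul, one_mul]
      omega
  refine (key m (fun a ha => hm.subset ha) (z c)).trans (Nat.add_le_add_left ?_ _)
  exact Nat.mul_le_mul_right _ (hm.length_le.trans (length_le_meas _))

end PolyTime

/-! ### Closure under operations on truth values, lists and numbers -/

namespace PolyTime

variable {α β γ δ : Type} [Dat α] [Dat β] [Dat γ] [Dat δ]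

theorem of_eq {f g : α → β} (hf : PolyTime f) (h : ∀ a, f a = g a) : PolyTime g :=
  (funext h : f = g) ▸ hf

section Bool

variable {p q : γ → Bool}

theorem not (hp : PolyTime p) : PolyTime fun c => !p c :=
  (hp.cond (const false) (const true)).of_eq fun c => by cases p c <;> rfl

theorem and (hp : PolyTime p) (hq : PolyTime q) : PolyTime fun c => p c && q c :=
  (hp.cond hq (const false)).of_eq fun c => by cases p c <;> rfl

theorem or (hp : PolyTime p) (hq : PolyTime q) : PolyTime fun c => p c || q c :=
  (hp.cond (const true) hq).of_eq fun c => by cases p c <;> rfl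

theorem beq_bool (hp : PolyTime p) (hq : PolyTime q) : PolyTime fun c => p c == q c :=
  (hp.cond hq hq.not).of_eq fun c => by cases p c <;> cases q c <;> rfl

theorem xor (hp : PolyTime p) (hq : PolyTime q) : PolyTime fun c => Bool.xor (p c) (q c) :=
  (hp.cond hq.not hq).of_eq fun c => by cases p c <;> cases q c <;> rfl

end Bool

section List

variable {l l' : γ → List α}

theorem nil : PolyTime fun _ : γ => ([] : List α) := const []

theorem cons {a : γ → α} (ha : PolyTime a) (hl : PolyTime l) : PolyTime fun c => a c :: l c :=
  (ha.pair hl).of_enc (fun _ => rfl) ((ha.pair hl).meas_bdd.mono fun _ => by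
    rw [meas_cons, meas_pair])

theorem tail (hl : PolyTime l) : PolyTime fun c => (l c).tail := by
  have : PolyTime fun l : List α => l.tail :=
    ⟨.tl, fun l => by cases l <;> rfl, ((PolyBdd.const 100).mul polyBdd_size).mono fun a => by
      rw [Code.cost], PolyBdd.meas_self.mono fun l => by
        change meas l.tail ≤ meas l
        cases l with
        | nil => exact le_rfl
        | cons a l => rw [meas_cons, List.tail_cons]; omega⟩
  exact this.comp hl

theorem isEmpty (hl : PolyTime l) : PolyTime fun c => (l c).isEmpty := by
  obtain ⟨c, hc, hc'⟩ := exists_const (α := List α) (enc true)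
  have : PolyTime fun l : List α => l.isEmpty := by
    refine ⟨.ite .id .nil c, fun l => ?_, ?_, PolyBdd.const 3⟩
    · cases l
      · exact hc _
      · rfl
    · refine ((PolyBdd.const 1).add ((PolyBdd.const 100).mul (polyBdd_size.add polyBdd_size))
        |>.add (hc'.add (((PolyBdd.const 10).mul polyBdd_size).add (PolyBdd.const 10)))).mono
          fun l => ?_
      rw [Code.cost, Code.cost, Code.eval]
      refine Nat.add_le_add_left ?_ _
      cases l
      · exact Nat.le_add_right _ _
      · exact Nat.le_add_left _ _
  exact this.comp hl

theorem headD {d : γ → α} (hl : PolyTime l) (hd : PolyTime d) :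
    PolyTime fun c => (l c).headD (d c) := by
  have : PolyTime fun p : List α × α => p.1.headD p.2 := by
    refine ⟨.ite .hd (.comp .hd .hd) .tl, fun p => ?_, ?_, PolyBdd.meas_self.mono fun p => ?_⟩
    · obtain ⟨_ | ⟨a, l⟩, d⟩ := p <;> rfl
    · refine (((PolyBdd.const 100).mul polyBdd_size).add ((PolyBdd.const 100).mul
        (polyBdd_size.add (fst' (α := List α) (β := α)).size_bdd)) |>.add
          (((((PolyBdd.const 100).mul (fst' (α := List α) (β := α)).size_bdd)).add
            ((PolyBdd.const 100).mul polyBdd_size)).add (PolyBdd.const 1))).mono fun p => ?_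
      obtain ⟨l, d⟩ := p
      rw [Code.cost, Code.cost, Code.cost, Code.cost, Code.cost]
      refine Nat.add_le_add_left ?_ _
      cases l with
      | nil => exact (Nat.le_add_left _ _).trans (Nat.le_add_right _ _)
      | cons a l => exact le_rfl
    · obtain ⟨_ | ⟨a, l⟩, d⟩ := p
      · exact (Nat.le_add_left _ _).trans (Nat.le_add_right _ _)
      · simp only [List.headD_cons, meas_pair, meas_cons]
        omega
  exact this.comp (hl.pair hd)

theorem reverse (hl : PolyTime l) : PolyTime fun c => (l c).reverse := by
  have key : ∀ l b : List α, l.foldl (fun b a => a :: b) b = l.reverse ++ b := by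
    intro l
    induction l with
    | nil => exact fun _ => rfl
    | cons a l ih => intro b; simp [ih]
  have : PolyTime fun c => (l c).foldl (fun b a => a :: b) [] :=
    foldl hl nil (cons (snd (snd id)) (fst (snd id))) (hl.meas_bdd.add (PolyBdd.const 1))
      fun c b a ha => by
        have := meas_le_of_mem ha
        rw [meas_cons]
        omega
  exact this.of_eq fun c => by simp [key]

theorem append (hl : PolyTime l) (hl' : PolyTime l') : PolyTime fun c => l c ++ l' c := by
  have key : ∀ l b : List α, l.foldl (fun b a => a :: b) b = l.reverse ++ b := by
    intro l
    induction l with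
    | nil => exact fun _ => rfl
    | cons a l ih => intro b; simp [ih]
  have : PolyTime fun c => (l c).reverse.foldl (fun b a => a :: b) (l' c) :=
    foldl hl.reverse hl' (cons (snd (snd id)) (fst (snd id)))
      (hl.meas_bdd.add (PolyBdd.const 1)) fun c b a ha => by
        have := meas_le_of_mem (List.mem_reverse.1 ha)
        rw [meas_cons]
        omega
  exact this.of_eq fun c => by simp [key]

/-- The elements of a list are no larger than the list. A bound in terms of `(c, a)` thus becomes
one in terms of `c` alone, the form needed for `foldl`. -/
theorem exists_bound (hl : PolyTime l) {h : γ × α → ℕ} (hh : PolyBdd h) :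
    ∃ B : γ → ℕ, PolyBdd B ∧ ∀ c, ∀ a ∈ l c, h (c, a) ≤ B c := by
  obtain ⟨k, hk⟩ := hh
  refine ⟨fun c => (meas c + meas (l c) + 3) ^ k,
    ((PolyBdd.meas_self.add hl.meas_bdd).add (PolyBdd.const 3)).pow k, fun c a ha => ?_⟩
  refine (hk _).trans (Nat.pow_le_pow_left ?_ k)
  have := meas_le_of_mem ha
  rw [meas_pair]
  omega

theorem flatMap {g : γ → α → List β} (hl : PolyTime l)
    (hg : PolyTime fun p : γ × α => g p.1 p.2) : PolyTime fun c => (l c).flatMap (g c) := by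
  have key : ∀ (c : γ) (l : List α) (b : List β),
      l.foldl (fun b a => b ++ g c a) b = b ++ l.flatMap (g c) := by
    intro c l
    induction l with
    | nil => intro b; simp
    | cons a l ih => intro b; simp [ih]
  obtain ⟨B, hB, h⟩ := exists_bound hl hg.meas_bdd
  have : PolyTime fun c => (l c).foldl (fun b a => b ++ g c a) [] :=
    foldl hl nil (append (fst (snd id)) (hg.comp ((fst id).pair (snd (snd id))))) hB
      fun c b a ha => by
        have h1 := h c a ha
        have h2 := meas_append b (g c a)
        change meas (g c a) ≤ B c at h1
        omega
  exact this.of_eq fun c => by simp [key]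

theorem map {g : γ → α → β} (hl : PolyTime l) (hg : PolyTime fun p : γ × α => g p.1 p.2) :
    PolyTime fun c => (l c).map (g c) :=
  (flatMap (g := fun c a => [g c a]) hl (cons hg nil)).of_eq fun c => by
    rw [List.map_eq_flatMap]

theorem filter {p : γ → α → Bool} (hl : PolyTime l)
    (hp : PolyTime fun q : γ × α => p q.1 q.2) : PolyTime fun c => (l c).filter (p c) :=
  (flatMap (g := fun c a => bif p c a then [a] else []) hl
    (hp.cond (cons (snd id) nil) nil)).of_eq fun c => by
      induction l c with
      | nil => rfl
      | cons a l ih =>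
        rw [List.flatMap_cons, ih, List.filter_cons]
        cases p c a <;> rfl

theorem any {p : γ → α → Bool} (hl : PolyTime l) (hp : PolyTime fun q : γ × α => p q.1 q.2) :
    PolyTime fun c => (l c).any (p c) := by
  have : PolyTime fun c => (l c).foldl (fun b a => b || p c a) false :=
    foldl hl (const false) (or (fst (snd id)) (hp.comp ((fst id).pair (snd (snd id)))))
      (PolyBdd.const 0) fun c b a _ => le_rfl
  refine this.of_eq fun c => ?_
  have key : ∀ (l : List α) (b : Bool), l.foldl (fun b a => b || p c a) b = (b || l.any (p c)) := by
    intro l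
    induction l with
    | nil => intro b; simp
    | cons a l ih => intro b; simp [ih, Bool.or_assoc]
  simp [key]

theorem all {p : γ → α → Bool} (hl : PolyTime l) (hp : PolyTime fun q : γ × α => p q.1 q.2) :
    PolyTime fun c => (l c).all (p c) :=
  (any hl hp.not).not.of_eq fun _ => List.all_eq_not_any_not.symm

end List

section Nat

variable {m n : γ → ℕ}

theorem replicate_unit (hn : PolyTime n) : PolyTime fun c => List.replicate (n c) () :=
  hn.of_enc (fun c => by
      change SExp.ofList ((List.replicate (n c) ()).map _) = SExp.ofList (List.replicate _ _)
      rw [List.map_replicate]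
      rfl)
    (hn.meas_bdd.mono fun c => (meas_list_le (B := 1) fun _ _ => le_rfl).trans (by
      rw [meas_nat, List.length_replicate]; omega))

theorem length {l : γ → List α} (hl : PolyTime l) : PolyTime fun c => (l c).length := by
  have : PolyTime fun c => (l c).map fun _ => () := map hl (const ())
  refine this.of_enc (fun c => ?_) ((hl.meas_bdd.mul (PolyBdd.const 2)).add
    (PolyBdd.const 1) |>.mono fun c => ?_)
  · change SExp.ofList (List.replicate _ _) = SExp.ofList (((l c).map _).map _)
    rw [List.map_map]
    congr 1
    exact List.map_const'.symm
  · rw [meas_nat]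
    have := length_le_meas (l c)
    omega

theorem add (hm : PolyTime m) (hn : PolyTime n) : PolyTime fun c => m c + n c :=
  (length (append hm.replicate_unit hn.replicate_unit)).of_eq fun c => by simp

theorem mul (hm : PolyTime m) (hn : PolyTime n) : PolyTime fun c => m c * n c :=
  (length (flatMap (g := fun c _ => List.replicate (n c) ()) hm.replicate_unit
    (hn.replicate_unit.comp (fst id)))).of_eq fun c => by
      simp [List.length_flatMap]

end Nat

section List

variable {l : γ → List α}

/-- The state of the fold contains a countdown in unary notation. -/
theorem take {n : γ → ℕ} (hn : PolyTime n) (hl : PolyTime l) :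
    PolyTime fun c => (l c).take (n c) := by
  have : PolyTime fun c => (l c).foldl (fun (b : List α × List Unit) a =>
      bif b.2.isEmpty then b else (a :: b.1, b.2.tail)) ([], List.replicate (n c) ()) :=
    foldl hl (nil.pair hn.replicate_unit)
      (cond (isEmpty (snd (fst (snd id)))) (fst (snd id))
        ((cons (snd (snd id)) (fst (fst (snd id)))).pair (tail (snd (fst (snd id))))))
      (hl.meas_bdd.add (PolyBdd.const 1)) fun c b a ha => by
        obtain ⟨o, k⟩ := b
        have := meas_le_of_mem ha
        cases k with
        | nil => exact Nat.le_add_right _ _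
        | cons u k =>
          change meas (a :: o, k) ≤ meas (o, u :: k) + (meas (l c) + 1)
          rw [meas_pair, meas_pair, meas_cons, meas_cons]
          omega
  refine (reverse (fst this)).of_eq fun c => ?_
  have key : ∀ (l o : List α) (k : ℕ), (l.foldl (fun (b : List α × List Unit) a =>
      bif b.2.isEmpty then b else (a :: b.1, b.2.tail)) (o, List.replicate k ())).1.reverse =
        o.reverse ++ l.take k := by
    intro l
    induction l with
    | nil => intro o k; simp
    | cons a l ih =>
      intro o k
      cases k with
      | zero => simpa using ih o 0
      | succ k => simpa [List.replicate_succ] using ih (a :: o) k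
  simpa using key (l c) [] (n c)

/-- The fold runs over the first list and consumes the second one, which is part of the state; `take
1` replaces a case distinction on it. -/
theorem zip {l' : γ → List β} (hl : PolyTime l) (hl' : PolyTime l') :
    PolyTime fun c => (l c).zip (l' c) := by
  have : PolyTime fun c => (l c).foldl (fun (b : List (α × β) × List β) a =>
      (((b.2.take 1).map fun x => (a, x)) ++ b.1, b.2.tail)) ([], l' c) :=
    foldl hl (nil.pair hl')
      ((append (map (g := fun (c : γ × (List (α × β) × List β) × α) x => (c.2.2, x))
          (take (const 1) (snd (fst (snd id)))) ((snd (snd (fst id))).pair (snd id)))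
        (fst (fst (snd id)))).pair (tail (snd (fst (snd id)))))
      (hl.meas_bdd.add (PolyBdd.const 1)) fun c b a ha => by
        obtain ⟨o, k⟩ := b
        have := meas_le_of_mem ha
        cases k with
        | nil => exact Nat.le_add_right _ _
        | cons u k =>
          change meas ((a, u) :: o, k) ≤ meas (o, u :: k) + (meas (l c) + 1)
          rw [meas_pair, meas_pair, meas_cons, meas_cons, meas_pair]
          omega
  refine (reverse (fst this)).of_eq fun c => ?_
  have key : ∀ (l : List α) (o : List (α × β)) (k : List β),
      (l.foldl (fun (b : List (α × β) × List β) a =>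
        (((b.2.take 1).map fun x => (a, x)) ++ b.1, b.2.tail)) (o, k)).1.reverse =
          o.reverse ++ l.zip k := by
    intro l
    induction l with
    | nil => intro o k; simp
    | cons a l ih =>
      intro o k
      cases k with
      | nil => simpa using ih o []
      | cons u k => simpa using ih ((a, u) :: o) k
  simpa using key (l c) [] (l' c)

theorem takeWhile {p : γ → α → Bool} (hl : PolyTime l)
    (hp : PolyTime fun q : γ × α => p q.1 q.2) : PolyTime fun c => (l c).takeWhile (p c) := by
  have : PolyTime fun c => (l c).foldl (fun (b : Bool × List α) a =>
      bif b.1 && p c a then (true, a :: b.2) else (false, b.2)) (true, []) :=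
    foldl hl (const _)
      (cond (and (fst (fst (snd id))) (hp.comp ((fst id).pair (snd (snd id)))))
        ((const true).pair (cons (snd (snd id)) (snd (fst (snd id)))))
        ((const false).pair (snd (fst (snd id)))))
      (hl.meas_bdd.add (PolyBdd.const 1)) fun c b a ha => by
        obtain ⟨o, k⟩ := b
        have := meas_le_of_mem ha
        dsimp only
        cases o && p c a
        · exact Nat.le_add_right _ _
        · simp only [cond_true, meas_pair, meas_cons, meas_bool]
          omega
  refine (reverse (snd this)).of_eq fun c => ?_
  have key : ∀ (l o : List α) (b : Bool), (l.foldl (fun (b : Bool × List α) a =>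
      bif b.1 && p c a then (true, a :: b.2) else (false, b.2)) (b, o)).2.reverse =
        o.reverse ++ bif b then l.takeWhile (p c) else [] := by
    intro l
    induction l with
    | nil => intro o b; cases b <;> simp
    | cons a l ih =>
      intro o b
      cases h : p c a <;> cases b <;> simp [h, ih]
  simpa using key (l c) [] true

theorem dropWhile {p : γ → α → Bool} (hl : PolyTime l)
    (hp : PolyTime fun q : γ × α => p q.1 q.2) : PolyTime fun c => (l c).dropWhile (p c) := by
  have : PolyTime fun c => (l c).foldl (fun (b : Bool × List α) a =>
      bif b.1 && p c a then (true, b.2) else (false, a :: b.2)) (true, []) :=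
    foldl hl (const _)
      (cond (and (fst (fst (snd id))) (hp.comp ((fst id).pair (snd (snd id)))))
        ((const true).pair (snd (fst (snd id))))
        ((const false).pair (cons (snd (snd id)) (snd (fst (snd id))))))
      (hl.meas_bdd.add (PolyBdd.const 1)) fun c b a ha => by
        obtain ⟨o, k⟩ := b
        have := meas_le_of_mem ha
        dsimp only
        cases o && p c a
        · simp only [cond_false, meas_pair, meas_cons, meas_bool]
          omega
        · exact Nat.le_add_right _ _
  refine (reverse (snd this)).of_eq fun c => ?_
  have key : ∀ (l o : List α) (b : Bool), (l.foldl (fun (b : Bool × List α) a =>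
      bif b.1 && p c a then (true, b.2) else (false, a :: b.2)) (b, o)).2.reverse =
        o.reverse ++ bif b then l.dropWhile (p c) else l := by
    intro l
    induction l with
    | nil => intro o b; cases b <;> simp
    | cons a l ih =>
      intro o b
      cases h : p c a <;> cases b <;> simp [h, ih]
  simpa using key (l c) [] true

theorem beq_list {l l' : γ → List Bool} (hl : PolyTime l) (hl' : PolyTime l') :
    PolyTime fun c => l c == l' c := by
  have : PolyTime fun c => (l c).foldl (fun (b : Bool × List Bool) a =>
      (b.1 && (b.2.take 1).any (a == ·), b.2.tail)) (true, l' c) :=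
    foldl hl ((const true).pair hl')
      ((and (fst (fst (snd id)))
        (any (p := fun (c : γ × (Bool × List Bool) × Bool) x => c.2.2 == x)
          (take (const 1) (snd (fst (snd id)))) (beq_bool (snd (snd (fst id))) (snd id)))).pair
        (tail (snd (fst (snd id)))))
      (PolyBdd.const 0) fun c b a ha => by
        obtain ⟨o, k⟩ := b
        cases k with
        | nil => exact le_rfl
        | cons x k => simp only [List.tail_cons, meas_pair, meas_cons, meas_bool]; omega
  refine (and (fst this) (isEmpty (snd this))).of_eq fun c => ?_
  have key : ∀ (l k : List Bool) (b : Bool),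
      ((l.foldl (fun (b : Bool × List Bool) a =>
        (b.1 && (b.2.take 1).any (a == ·), b.2.tail)) (b, k)).1 &&
      (l.foldl (fun (b : Bool × List Bool) a =>
        (b.1 && (b.2.take 1).any (a == ·), b.2.tail)) (b, k)).2.isEmpty) = (b && (l == k)) := by
    intro l
    induction l with
    | nil => intro k b; cases k <;> cases b <;> rfl
    | cons a l ih =>
      intro k b
      rw [List.foldl_cons, ih]
      cases k with
      | nil => simp
      | cons u k => simp [Bool.and_assoc]
  simpa using key (l c) (l' c) true

end List

end PolyTime

/-! ### The exhaustive search on queries written with binary names -/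

/-- The binary notation of the successor of a number in binary notation. -/
def incr : List Bool → List Bool
  | [] => [true]
  | false :: l => true :: l
  | true :: l => false :: incr l

theorem encodePosNum_succ (p : PosNum) :
    Computability.encodePosNum p.succ = incr (Computability.encodePosNum p) := by
  induction p with
  | one => rfl
  | bit0 p _ => rfl
  | bit1 p ih => exact congrArg (List.cons false) ih

theorem encodeNat_succ (n : ℕ) :
    Computability.encodeNat (n + 1) = incr (Computability.encodeNat n) := by
  unfold Computability.encodeNat
  rw [Nat.cast_add_one, Num.add_one]
  cases (n : Num) with
  | zero => rfl
  | pos p => exact encodePosNum_succ p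

theorem length_incr_le (l : List Bool) : (incr l).length ≤ l.length + 1 := by
  induction l with
  | nil => simp [incr]
  | cons a l ih => cases a <;> simp [incr]; omega

theorem length_encodeNat_le (n : ℕ) : (Computability.encodeNat n).length ≤ n := by
  induction n with
  | zero => exact le_rfl
  | succ n ih =>
    rw [encodeNat_succ]
    have := length_incr_le (Computability.encodeNat n)
    omega

theorem Dat.meas_bits (l : List Bool) : meas l = 4 * l.length + 1 := by
  induction l with
  | nil => rfl
  | cons a l ih => rw [meas_cons, meas_bool, ih, List.length_cons]; omega

/-- All lists of length `m` with entries from `L`, but at most `b` lists of each length. -/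
def tuples {β : Type} (b : ℕ) (L : List β) : ℕ → List (List β)
  | 0 => [[]]
  -- The cut-off keeps all intermediate results polynomial in `b`, whatever `L` and `m` are; by
  -- `mem_tuples_iff` it has no effect for large `b`.
  | m + 1 => ((tuples b L m).flatMap fun t => L.map (· :: t)).take b

/-- The summand 1 is due to the empty tuple, which is not subject to the cut-off. -/
theorem length_tuples_le {β : Type} (b : ℕ) (L : List β) (m : ℕ) :
    (tuples b L m).length ≤ b + 1 := by
  cases m with
  | zero => simp [tuples]
  | succ m => exact (List.length_take_le _ _).trans (Nat.le_succ b)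

theorem mem_of_mem_tuples {β : Type} {b : ℕ} {L : List β} {m : ℕ} {t : List β}
    (h : t ∈ tuples b L m) : t.length = m ∧ ∀ x ∈ t, x ∈ L := by
  induction m generalizing t with
  | zero => simp only [tuples, List.mem_singleton] at h; subst h; simp
  | succ m ih =>
    obtain ⟨s, hs, h⟩ := List.mem_flatMap.1 (List.mem_of_mem_take h)
    obtain ⟨x, hx, rfl⟩ := List.mem_map.1 h
    obtain ⟨h1, h2⟩ := ih hs
    refine ⟨by simp [h1], fun y hy => ?_⟩
    rcases List.mem_cons.1 hy with rfl | hy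
    · exact hx
    · exact h2 y hy

/-- Names of relations and variables: numbers in binary notation. -/
abbrev Name : Type := List Bool

/-- Atoms with names as in the input. -/
abbrev RawAtom : Type := Name × List Name

/-- Queries with names as in the input: the head variables and the atoms of the body. -/
abbrev RawQuery : Type := List Name × List RawAtom

/-- The names of the numbers below `n`. -/
def names (n : ℕ) : List Name := (List.range n).map Computability.encodeNat

namespace RawQuery

/-- The given pairs belong to a function. -/
def isFunctional (l : List (Name × Name)) : Bool :=
  l.all fun p => l.all fun q => !(p.1 == q.1) || p.2 == q.2

/-- Some mapping of the variables of `v` maps the head of `v` to that of `u` and the atoms of `v`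
to the atoms `c`. -/
def isMatch (u v : RawQuery) (c : List RawAtom) : Bool :=
  ((v.2.zip c).all fun p => p.1.1 == p.2.1) &&
    isFunctional (v.1.zip u.1 ++ (v.2.zip c).flatMap fun p => p.1.2.zip p.2.2)

/-- The query `u` is contained in `v`, where `b` bounds the number of candidates considered. -/
def le (b : ℕ) (u v : RawQuery) : Bool :=
  (tuples b u.2 v.2.length).any (isMatch u v)

/-- Equivalence of queries. -/
def equiv (b : ℕ) (u v : RawQuery) : Bool := le b u v && le b v u

/-- Maximal containment with respect to the class of queries `V`. -/
def maxLe (b : ℕ) (V : List RawQuery) (u v : RawQuery) : Bool :=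
  le b u v && !le b v u &&
    V.all fun w => !(le b u w && le b w v) || (equiv b u w || equiv b w v)

/-- Equivalent queries or queries of distance one. -/
def near (b : ℕ) (V : List RawQuery) (u v : RawQuery) : Bool :=
  equiv b u v || (maxLe b V u v || maxLe b V v u)

/-- One step of a breadth-first search for `v`; the state is the set of the queries reached and the
number of steps made. -/
def searchStep (b : ℕ) (V : List RawQuery) (v : RawQuery) (s : List RawQuery × ℕ) :
    List RawQuery × ℕ :=
  bif s.1.any fun w => equiv b w v then s
  else (V.filter fun w => s.1.any fun w' => near b V w' w, s.2 + 1)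

/-- The distance of `u` and `v`. -/
def dist (b : ℕ) (V : List RawQuery) (u v : RawQuery) : ℕ :=
  -- The elements of `V` are ignored. The fold only makes `V.length` rounds, which suffice by
  -- `TwoCQ.reach_length`.
  (V.foldl (fun s _ => searchStep b V v s) ([u], 0)).2

/-- All atoms with variables from `L` over the schema with given arities in unary notation. -/
def atoms (b : ℕ) (L : List Name) (ars : List Name) : List RawAtom :=
  ((names ars.length).zip ars).flatMap fun p => (tuples b L p.2.length).map fun t => (p.1, t)

/-- All non-empty lists of at most `n` elements of `A`. -/
def bodies (b : ℕ) (A : List RawAtom) (n : ℕ) : List (List RawAtom) :=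
  (List.range n).flatMap fun m => tuples b A (m + 1)

/-- No relation name occurs more than twice and the head variables occur in the body. -/
def isValid (q : RawQuery) : Bool :=
  (q.2.all fun A => (q.2.filter fun A' => A'.1 == A.1).tail.tail.isEmpty) &&
    q.1.all fun z => q.2.any fun A => A.2.any fun y => y == z

/-- All queries of arity `k` over the schema with given arities that have few variables. -/
def queries (b : ℕ) (ars : List Name) (k : ℕ) : List RawQuery :=
  -- `ars.flatten.length` is the sum of the arities, and twice this number bounds the occurrences of
  -- variables in the body of a 2CQ.
  ((tuples b (names (2 * ars.flatten.length)) k).flatMap fun h =>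
    (bodies b (atoms b (names (2 * ars.flatten.length)) ars) (2 * ars.length)).map fun B =>
      (h, B)).filter isValid

end RawQuery

/-! ### Polynomial cost of the search -/

namespace PolyTime

variable {α β γ : Type} [Dat α] [Dat β] [Dat γ]

/-- Iteration with polynomially bounded intermediate results. -/
theorem iterate {n : γ → ℕ} {g : γ → β → β} {F : γ → ℕ → β} (hn : PolyTime n)
    (hz : PolyTime fun c => F c 0) (hg : PolyTime fun p : γ × β => g p.1 p.2)
    (hF : ∀ c m, F c (m + 1) = g c (F c m)) {B : γ → ℕ} (hB : PolyBdd B)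
    (h : ∀ c, ∀ m ≤ n c, meas (F c m) ≤ B c) : PolyTime fun c => F c (n c) := by
  have key : ∀ c m, (List.replicate m ()).foldl (fun b _ => g c b) (F c 0) = F c m := by
    intro c m
    induction m with
    | zero => rfl
    | succ m ih => rw [List.replicate_succ', List.foldl_append, ih, hF]; rfl
  refine (foldl_of_bdd (g := fun c b _ => g c b) hn.replicate_unit hz
    (hg.comp ((fst id).pair (fst (snd id)))) hB fun c m hm => ?_).of_eq fun c => key c (n c)
  have hm' : m = List.replicate m.length () := by
    refine List.eq_replicate_iff.2 ⟨rfl, fun _ _ => rfl⟩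
  rw [hm', key]
  refine h c _ ?_
  simpa using hm.length_le

/-- The state consists of the carry and of the digits produced so far, in reversed order. -/
theorem incr {l : γ → List Bool} (hl : PolyTime l) : PolyTime fun c => incr (l c) := by
  have : PolyTime fun c => (l c).foldl (fun (b : Bool × List Bool) a =>
      (b.1 && a, Bool.xor b.1 a :: b.2)) (true, []) :=
    foldl hl (const _) ((and (fst (fst (snd id))) (snd (snd id))).pair
      (cons (xor (fst (fst (snd id))) (snd (snd id))) (snd (fst (snd id)))))
      (PolyBdd.const 4) fun c b a ha => by
        obtain ⟨o, k⟩ := b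
        simp only [meas_pair, meas_cons, meas_bool]
        omega
  refine (reverse (cond (fst this) (cons (const true) (snd this)) (snd this))).of_eq fun c => ?_
  have key : ∀ (l o : List Bool) (b : Bool),
      (bif (l.foldl (fun (b : Bool × List Bool) a => (b.1 && a, Bool.xor b.1 a :: b.2)) (b, o)).1
        then true :: (l.foldl (fun (b : Bool × List Bool) a =>
          (b.1 && a, Bool.xor b.1 a :: b.2)) (b, o)).2
        else (l.foldl (fun (b : Bool × List Bool) a =>
          (b.1 && a, Bool.xor b.1 a :: b.2)) (b, o)).2).reverse =
      o.reverse ++ bif b then _root_.incr l else l := by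
    intro l
    induction l with
    | nil => intro o b; cases b <;> simp [_root_.incr]
    | cons a l ih =>
      intro o b
      rw [List.foldl_cons, ih]
      cases a <;> cases b <;> simp [_root_.incr]
  simpa using key (l c) [] true

theorem names {n : γ → ℕ} (hn : PolyTime n) : PolyTime fun c => names (n c) := by
  refine (snd (iterate (F := fun _ m => (Computability.encodeNat m, _root_.names m))
    (g := fun _ p => (_root_.incr p.1, p.2 ++ [p.1])) hn (const _)
    ((incr (fst (snd id))).pair (append (snd (snd id)) (cons (fst (snd id)) nil)))
    (fun c m => ?_) (B := fun c => 4 * n c + 1 + (n c * (4 * n c + 1 + 1) + 1) + 1) ?_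
    fun c m hm => ?_))
  · rw [encodeNat_succ, _root_.names, List.range_succ, List.map_append]
    rfl
  · have h : PolyBdd n := hn.meas_bdd.mono fun c => by rw [meas_nat]; omega
    exact ((((PolyBdd.const 4).mul h).add (PolyBdd.const 1)).add ((h.mul ((((PolyBdd.const 4).mul
      h).add (PolyBdd.const 1)).add (PolyBdd.const 1))).add (PolyBdd.const 1))).add
        (PolyBdd.const 1)
  · have h1 : ∀ k ≤ n c, meas (Computability.encodeNat k) ≤ 4 * n c + 1 := fun k hk => by
      rw [meas_bits]
      have := length_encodeNat_le k
      omega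
    have h2 : meas (_root_.names m) ≤ n c * (4 * n c + 1 + 1) + 1 := by
      refine (meas_list_le (B := 4 * n c + 1) fun a ha => ?_).trans
        (Nat.add_le_add_right (Nat.mul_le_mul_right _ ?_) _)
      · obtain ⟨k, hk, rfl⟩ := List.mem_map.1 ha
        exact h1 k ((List.mem_range.1 hk).le.trans hm)
      · simpa [_root_.names] using hm
    have := h1 m hm
    rw [meas_pair]
    omega

theorem range {n : γ → ℕ} (hn : PolyTime n) : PolyTime fun c => List.range (n c) := by
  refine iterate (F := fun _ m => List.range m) (g := fun _ l => l ++ [l.length]) hn (const _)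
    (append (snd id) (cons (length (snd id)) nil)) (fun c m => ?_)
    (B := fun c => n c * (2 * n c + 1 + 1) + 1) ?_ fun c m hm => ?_
  · rw [List.range_succ, List.length_range]
  · have h : PolyBdd n := hn.meas_bdd.mono fun c => by rw [meas_nat]; omega
    exact (h.mul ((((PolyBdd.const 2).mul h).add (PolyBdd.const 1)).add (PolyBdd.const 1))).add
      (PolyBdd.const 1)
  · refine (meas_list_le (B := 2 * n c + 1) fun a ha => ?_).trans
      (Nat.add_le_add_right (Nat.mul_le_mul_right _ (by simpa using hm)) _)
    have := List.mem_range.1 ha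
    rw [meas_nat]
    omega

theorem tuples {b m : γ → ℕ} {L : γ → List β} (hb : PolyTime b) (hL : PolyTime L)
    (hm : PolyTime m) : PolyTime fun c => tuples (b c) (L c) (m c) := by
  refine iterate (F := fun c m => _root_.tuples (b c) (L c) m) (g := fun c l =>
    (l.flatMap fun t => (L c).map (· :: t)).take (b c)) hm (const _)
    (take (hb.comp (fst id)) (flatMap (g := fun (p : γ × List (List β)) t =>
      (L p.1).map (· :: t)) (snd id) (map (g := fun (q : (γ × List (List β)) × List β) x =>
        x :: q.2) (hL.comp (fst (fst id))) (cons (snd id) (snd (fst id)))))) (fun _ _ => rfl)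
    (B := fun c => (b c + 1) * (m c * (meas (L c) + 1) + 1 + 1) + 1) ?_ fun c k hk => ?_
  · have h : PolyBdd b := hb.meas_bdd.mono fun c => by rw [meas_nat]; omega
    have h' : PolyBdd m := hm.meas_bdd.mono fun c => by rw [meas_nat]; omega
    exact ((h.add (PolyBdd.const 1)).mul (((h'.mul (hL.meas_bdd.add (PolyBdd.const 1))).add
      (PolyBdd.const 1)).add (PolyBdd.const 1))).add (PolyBdd.const 1)
  · refine (meas_list_le (B := m c * (meas (L c) + 1) + 1) fun t ht => ?_).trans
      (Nat.add_le_add_right (Nat.mul_le_mul_right _ (length_tuples_le _ _ _)) _)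
    obtain ⟨h1, h2⟩ := mem_of_mem_tuples ht
    refine (meas_list_le (B := meas (L c)) fun x hx => meas_le_of_mem (h2 x hx)).trans ?_
    rw [h1]
    exact Nat.add_le_add_right (Nat.mul_le_mul_right _ hk) _

section Query

open RawQuery

variable {b : γ → ℕ} {u v : γ → RawQuery} {V : γ → List RawQuery}

theorem isFunctional {l : γ → List (Name × Name)} (hl : PolyTime l) :
    PolyTime fun c => isFunctional (l c) :=
  all (p := fun c (p : Name × Name) => (l c).all fun q => !(p.1 == q.1) || p.2 == q.2) hl
    (all (p := fun (c : γ × Name × Name) q => !(c.2.1 == q.1) || c.2.2 == q.2) (hl.comp (fst id))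
      (or (not (beq_list (fst (snd (fst id))) (fst (snd id))))
        (beq_list (snd (snd (fst id))) (snd (snd id)))))

theorem isMatch {d : γ → List RawAtom} (hu : PolyTime u) (hv : PolyTime v) (hd : PolyTime d) :
    PolyTime fun c => isMatch (u c) (v c) (d c) :=
  and (all (p := fun _ (p : RawAtom × RawAtom) => p.1.1 == p.2.1) (zip (snd hv) hd)
      (beq_list (fst (fst (snd id))) (fst (snd (snd id)))))
    (isFunctional (append (zip (fst hv) (fst hu))
      (flatMap (g := fun _ (p : RawAtom × RawAtom) => p.1.2.zip p.2.2) (zip (snd hv) hd)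
        (zip (snd (fst (snd id))) (snd (snd (snd id)))))))

theorem le (hb : PolyTime b) (hu : PolyTime u) (hv : PolyTime v) :
    PolyTime fun c => le (b c) (u c) (v c) :=
  any (p := fun c => RawQuery.isMatch (u c) (v c)) (tuples hb (snd hu) (length (snd hv)))
    (isMatch (hu.comp (fst id)) (hv.comp (fst id)) (snd id))

theorem equiv (hb : PolyTime b) (hu : PolyTime u) (hv : PolyTime v) :
    PolyTime fun c => equiv (b c) (u c) (v c) :=
  and (le hb hu hv) (le hb hv hu)

theorem maxLe (hb : PolyTime b) (hV : PolyTime V) (hu : PolyTime u) (hv : PolyTime v) :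
    PolyTime fun c => maxLe (b c) (V c) (u c) (v c) := by
  have hb' : PolyTime fun p : γ × RawQuery => b p.1 := hb.comp (fst id)
  have hu' : PolyTime fun p : γ × RawQuery => u p.1 := hu.comp (fst id)
  have hv' : PolyTime fun p : γ × RawQuery => v p.1 := hv.comp (fst id)
  have hw : PolyTime fun p : γ × RawQuery => p.2 := snd id
  exact and (and (le hb hu hv) (not (le hb hv hu))) (all (p := fun c w =>
    !(RawQuery.le (b c) (u c) w && RawQuery.le (b c) w (v c)) ||
      (RawQuery.equiv (b c) (u c) w || RawQuery.equiv (b c) w (v c))) hV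
    (or (not (and (le hb' hu' hw) (le hb' hw hv')))
      (or (equiv hb' hu' hw) (equiv hb' hw hv'))))

theorem near (hb : PolyTime b) (hV : PolyTime V) (hu : PolyTime u) (hv : PolyTime v) :
    PolyTime fun c => near (b c) (V c) (u c) (v c) :=
  or (equiv hb hu hv) (or (maxLe hb hV hu hv) (maxLe hb hV hv hu))

theorem meas_filter_le (p : α → Bool) (l : List α) : meas (l.filter p) ≤ meas l := by
  induction l with
  | nil => exact le_rfl
  | cons a l ih =>
    rw [List.filter_cons, meas_cons]
    split
    · rw [meas_cons]; omega
    · omega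

/-- The rounds are counted in binary from the start. Each round replaces the set of reached queries
by a sublist of `V` and adds at most one digit to the counter, whence the additive bound `meas V +
4`. -/
theorem encodeNat_dist (hb : PolyTime b) (hV : PolyTime V) (hu : PolyTime u) (hv : PolyTime v) :
    PolyTime fun c => Computability.encodeNat (dist (b c) (V c) (u c) (v c)) := by
  have : PolyTime fun c => (V c).foldl (fun (s : List RawQuery × Name) _ =>
      bif s.1.any fun w => RawQuery.equiv (b c) w (v c) then s
      else ((V c).filter fun w => s.1.any fun w' => RawQuery.near (b c) (V c) w' w,
        _root_.incr s.2)) ([u c], []) := by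
    refine foldl (g := fun c (s : List RawQuery × Name) _ =>
      bif s.1.any fun w => RawQuery.equiv (b c) w (v c) then s
      else ((V c).filter fun w => s.1.any fun w' => RawQuery.near (b c) (V c) w' w,
        _root_.incr s.2)) hV ((cons hu nil).pair nil)
      (cond (any (p := fun (q : γ × (List RawQuery × Name) × RawQuery) w =>
          RawQuery.equiv (b q.1) w (v q.1)) (fst (fst (snd id)))
          (equiv (hb.comp (fst (fst id))) (snd id) (hv.comp (fst (fst id)))))
        (fst (snd id))
        ((filter (p := fun (q : γ × (List RawQuery × Name) × RawQuery) w =>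
          q.2.1.1.any fun w' => RawQuery.near (b q.1) (V q.1) w' w) (hV.comp (fst id))
          (any (p := fun (q : (γ × (List RawQuery × Name) × RawQuery) × RawQuery) w' =>
              RawQuery.near (b q.1.1) (V q.1.1) w' q.2)
            (fst (fst (snd (fst id))))
            (near (hb.comp (fst (fst (fst id)))) (hV.comp (fst (fst (fst id)))) (snd id)
              (snd (fst id))))).pair
          (incr (snd (fst (snd id))))))
      (hV.meas_bdd.add (PolyBdd.const 4)) fun c s a _ => ?_
    cases s.1.any fun w => RawQuery.equiv (b c) w (v c)
    · have h1 := meas_filter_le (fun w => s.1.any fun w' => RawQuery.near (b c) (V c) w' w) (V c)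
      have h2 := length_incr_le s.2
      have h3 : meas s = meas s.1 + meas s.2 + 1 := rfl
      have h4 := meas_bits s.2
      rw [cond_false, meas_pair, meas_bits]
      omega
    · exact Nat.le_add_right _ _
  refine (snd this).of_eq fun c => ?_
  have key : ∀ (l : List RawQuery) (S : List RawQuery) (d : ℕ),
      l.foldl (fun (s : List RawQuery × Name) _ =>
        bif s.1.any fun w => RawQuery.equiv (b c) w (v c) then s
        else ((V c).filter fun w => s.1.any fun w' => RawQuery.near (b c) (V c) w' w,
          _root_.incr s.2)) (S, Computability.encodeNat d) =
      Prod.map _root_.id Computability.encodeNat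
        (l.foldl (fun s _ => searchStep (b c) (V c) (v c) s) (S, d)) := by
    intro l
    induction l with
    | nil => exact fun _ _ => rfl
    | cons a l ih =>
      intro S d
      rw [List.foldl_cons, List.foldl_cons, searchStep]
      dsimp only
      cases S.any fun w => RawQuery.equiv (b c) w (v c)
      · rw [cond_false, cond_false, ← encodeNat_succ, ih]
      · rw [cond_true, cond_true, ih]
  exact congrArg Prod.snd (key (V c) [u c] 0)

theorem atoms {L ars : γ → List Name} (hb : PolyTime b) (hL : PolyTime L)
    (ha : PolyTime ars) : PolyTime fun c => atoms (b c) (L c) (ars c) :=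
  flatMap (g := fun c (p : Name × Name) =>
      (_root_.tuples (b c) (L c) p.2.length).map fun t => (p.1, t)) (zip (names (length ha)) ha)
    (map (g := fun (q : γ × Name × Name) t => (q.2.1, t))
      (tuples (hb.comp (fst id)) (hL.comp (fst id)) (length (snd (snd id))))
      ((fst (snd (fst id))).pair (snd id)))

theorem bodies {A : γ → List RawAtom} {n : γ → ℕ} (hb : PolyTime b) (hA : PolyTime A)
    (hn : PolyTime n) : PolyTime fun c => bodies (b c) (A c) (n c) :=
  flatMap (g := fun c m => _root_.tuples (b c) (A c) (m + 1)) (range hn)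
    (tuples (hb.comp (fst id)) (hA.comp (fst id)) (add (snd id) (const 1)))

theorem isValid (hu : PolyTime u) : PolyTime fun c => isValid (u c) :=
  and
    (all (p := fun c A => ((u c).2.filter fun A' => A'.1 == A.1).tail.tail.isEmpty) (snd hu)
      (isEmpty (tail (tail (filter (p := fun (q : γ × RawAtom) (A' : RawAtom) => A'.1 == q.2.1)
        (snd (hu.comp (fst id))) (beq_list (fst (snd id)) (fst (snd (fst id)))))))))
    (all (p := fun c z => (u c).2.any fun A => A.2.any fun y => y == z) (fst hu)
      (any (p := fun (q : γ × Name) (A : RawAtom) => A.2.any fun y => y == q.2)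
        (snd (hu.comp (fst id)))
        (any (p := fun (q : (γ × Name) × RawAtom) y => y == q.1.2) (snd (snd id))
          (beq_list (snd id) (snd (fst (fst id)))))))

theorem queries {ars : γ → List Name} {k : γ → ℕ} (hb : PolyTime b) (ha : PolyTime ars)
    (hk : PolyTime k) : PolyTime fun c => queries (b c) (ars c) (k c) := by
  have hL : PolyTime fun c => _root_.names (2 * (ars c).flatten.length) :=
    names (mul (const 2) (length ((flatMap (g := fun _ l => l) ha (snd id)).of_eq fun c => by
      rw [List.flatMap_def, List.map_id'])))
  exact filter (p := fun _ => RawQuery.isValid) (flatMap (g := fun c h =>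
    (RawQuery.bodies (b c) (RawQuery.atoms (b c) (_root_.names (2 * (ars c).flatten.length))
      (ars c)) (2 * (ars c).length)).map fun B => (h, B)) (tuples hb hL hk)
    (map (g := fun (q : γ × List Name) B => (q.2, B))
      (bodies (hb.comp (fst id)) (atoms (hb.comp (fst id)) (hL.comp (fst id)) (ha.comp (fst id)))
        (mul (const 2) (length (ha.comp (fst id))))) ((snd (fst id)).pair (snd id))))
    (isValid (snd id))

end Query

end PolyTime

/-! ### Parsing the input word -/

instance : Dat InSymbol where
  enc := SExp.ofSymbol
  meas _ := 7
  size_enc_le := SExp.size_ofSymbol_le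

/-- Read a symbol in front of a text that consists of the given lines. The text is a sequence of
lines, each ended by a semicolon, which are sequences of words, each ended by a comma. -/
def parseStep : InSymbol → List (List Name) → List (List Name)
  -- The text is read from its end, so a semicolon opens a line and a comma opens a word; the
  -- defaults `[]` matter only for words that encode nothing.
  | .semicolon, t => [] :: t
  | .comma, t => ([] :: t.headD []) :: t.tail
  | .bit b, t => ((b :: (t.headD []).headD []) :: (t.headD []).tail) :: t.tail

/-- The lines of a text. -/
def parse (w : List InSymbol) : List (List Name) := w.foldr parseStep []

theorem meas_parseStep_le (s : InSymbol) (t : List (List Name)) :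
    meas (parseStep s t) ≤ meas t + 8 := by
  cases s with
  | semicolon => simp only [parseStep, meas_cons, meas_nil]; omega
  | comma => cases t <;> simp only [parseStep, meas_cons, meas_nil, List.headD_cons,
      List.headD_nil, List.tail_cons, List.tail_nil] <;> omega
  | bit b => rcases t with _ | ⟨_ | ⟨x, l⟩, t⟩ <;> simp only [parseStep, meas_cons, meas_nil,
      List.headD_cons, List.headD_nil, List.tail_cons, List.tail_nil, meas_bool] <;> omega

namespace PolyTime

theorem symbol : PolyTime fun s : InSymbol => match s with
    | .bit b => (false, b)
    | .comma => (true, false)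
    | .semicolon => (true, true) :=
  (id (α := InSymbol)).of_enc (fun s => by rcases s with (_ | _) | _ | _ <;> rfl)
    ((PolyBdd.const 7).mono fun _ => le_rfl)

theorem parseStep : PolyTime fun p : List (List Name) × InSymbol => parseStep p.2 p.1 := by
  have ht := fst (id (α := List (List Name) × InSymbol))
  have hs := symbol.comp (snd (id (α := List (List Name) × InSymbol)))
  refine (cond (fst hs) (cond (snd hs) (cons nil ht) (cons (cons nil (headD ht nil)) (tail ht)))
    (cons (cons (cons (snd hs) (headD (headD ht nil) nil)) (tail (headD ht nil)))
      (tail ht))).of_eq fun p => ?_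
  obtain ⟨t, s⟩ := p
  cases s <;> rfl

theorem parse : PolyTime parse := by
  refine (foldl (γ := List InSymbol) (l := fun w => w.reverse) (z := fun _ => [])
    (g := fun _ b a => _root_.parseStep a b) (reverse id) nil (parseStep.comp (snd id))
    (PolyBdd.const 8) fun _ b a _ => meas_parseStep_le a b).of_eq fun w => ?_
  rw [List.foldl_reverse]
  rfl

end PolyTime

/-- An atom with names. -/
def Atom.raw {σ : Schema} (A : Atom σ Var) : RawAtom :=
  (Computability.encodeNat A.rel, (List.ofFn A.args).map Computability.encodeNat)

/-- A query with names. -/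
def CQ.raw {σ : Schema} {α : ℕ} (Q : CQ σ α) : RawQuery :=
  ((List.ofFn Q.head).map Computability.encodeNat, Q.body.map Atom.raw)

/-- The arities of a schema in unary notation. -/
def Schema.unaryArities (σ : Schema) : List Name :=
  (List.ofFn σ.arity).map fun a => List.replicate a true

theorem foldr_parseStep_bits (t z : Name) (l : List Name) (ls : List (List Name)) :
    (t.map InSymbol.bit).foldr parseStep ((z :: l) :: ls) = ((t ++ z) :: l) :: ls := by
  induction t with
  | nil => rfl
  | cons b t ih => rw [List.map_cons, List.foldr_cons, ih]; rfl

theorem foldr_parseStep_words (ts l : List Name) (ls : List (List Name)) :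
    (ts.flatMap fun t => t.map InSymbol.bit ++ [InSymbol.comma]).foldr parseStep (l :: ls) =
      (ts ++ l) :: ls := by
  induction ts with
  | nil => rfl
  | cons t ts ih =>
    rw [List.flatMap_cons, List.foldr_append, ih, List.foldr_append]
    change (t.map InSymbol.bit).foldr parseStep (([] :: (ts ++ l)) :: ls) = _
    rw [foldr_parseStep_bits]
    simp

theorem foldr_parseStep_line (ts : List Name) (ls : List (List Name)) :
    ((ts.flatMap fun t => t.map InSymbol.bit ++ [InSymbol.comma]) ++
      [InSymbol.semicolon]).foldr parseStep ls = ts :: ls := by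
  rw [List.foldr_append]
  change (ts.flatMap _).foldr parseStep ([] :: ls) = _
  rw [foldr_parseStep_words, List.append_nil]

theorem foldr_parseStep_encodeSchema (σ : Schema) (ls : List (List Name)) :
    (encodeSchema σ).foldr parseStep ls = σ.unaryArities :: ls := by
  rw [← foldr_parseStep_line, encodeSchema, Schema.unaryArities, List.flatMap_map]
  simp

theorem foldr_parseStep_encodeAtom {σ : Schema} (A : Atom σ Var) (ls : List (List Name)) :
    (encodeAtom A).foldr parseStep ls = (A.raw.1 :: A.raw.2) :: ls := by
  rw [← foldr_parseStep_line, encodeAtom, Atom.raw, List.flatMap_cons, List.flatMap_map]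
  rfl

/-- The last semicolon of a query yields an empty line. The line of an atom is never empty, as it
contains the relation name, so the empty line marks the end of the body. -/
theorem foldr_parseStep_encodeQuery {σ : Schema} {α : ℕ} (Q : CQ σ α) (ls : List (List Name)) :
    (encodeQuery Q).foldr parseStep ls =
      Q.raw.1 :: (Q.raw.2.map fun A => A.1 :: A.2) ++ [] :: ls := by
  have key : ∀ (B : List (Atom σ Var)) (ls : List (List Name)),
      (B.flatMap encodeAtom).foldr parseStep ls =
        ((B.map Atom.raw).map fun A => A.1 :: A.2) ++ ls := by
    intro B ls
    induction B with
    | nil => rfl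
    | cons A B ih =>
      rw [List.flatMap_cons, List.foldr_append, ih, foldr_parseStep_encodeAtom]
      rfl
  rw [encodeQuery, List.foldr_append, List.foldr_append, key]
  refine Eq.trans ?_ (foldr_parseStep_line Q.raw.1 _)
  rw [CQ.raw, List.flatMap_map]
  rfl

/-- The query at the beginning of a list of lines. -/
def takeQuery (t : List (List Name)) : RawQuery :=
  (t.headD [], (t.tail.takeWhile fun l => !l.isEmpty).map fun l => (l.headD [], l.tail))

/-- The lines after the query at the beginning of a list of lines. -/
def dropQuery (t : List (List Name)) : List (List Name) :=
  (t.tail.dropWhile fun l => !l.isEmpty).tail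

theorem takeQuery_eq (q : RawQuery) (ls : List (List Name)) :
    takeQuery (q.1 :: (q.2.map fun A => A.1 :: A.2) ++ [] :: ls) = q := by
  obtain ⟨h, B⟩ := q
  simp only [takeQuery, List.cons_append, List.headD_cons, List.tail_cons]
  rw [List.takeWhile_append_of_pos fun _ h => by
    obtain ⟨A, _, rfl⟩ := List.mem_map.1 h
    rfl]
  simp only [List.isEmpty_nil, Bool.not_true, Bool.false_eq_true, not_false_eq_true,
    List.takeWhile_cons_of_neg, List.append_nil, List.map_map]
  exact congrArg _ (List.map_id B)

theorem dropQuery_eq (q : RawQuery) (ls : List (List Name)) :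
    dropQuery (q.1 :: (q.2.map fun A => A.1 :: A.2) ++ [] :: ls) = ls := by
  obtain ⟨h, B⟩ := q
  simp only [dropQuery, List.cons_append, List.tail_cons]
  rw [List.dropWhile_append_of_pos fun _ h => by
    obtain ⟨A, _, rfl⟩ := List.mem_map.1 h
    rfl]
  simp

theorem parse_encodeInput (x : DistInput) : parse (encodeInput x) =
    x.σ.unaryArities :: x.Q₁.1.raw.1 :: (x.Q₁.1.raw.2.map fun A => A.1 :: A.2) ++
      [] :: x.Q₂.1.raw.1 :: (x.Q₂.1.raw.2.map fun A => A.1 :: A.2) ++ [[]] := by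
  rw [parse, encodeInput, List.foldr_append, List.foldr_append, foldr_parseStep_encodeQuery,
    foldr_parseStep_encodeQuery, foldr_parseStep_encodeSchema]
  simp

namespace PolyTime

variable {γ : Type} [Dat γ]

theorem takeQuery {t : γ → List (List Name)} (ht : PolyTime t) :
    PolyTime fun c => takeQuery (t c) :=
  pair (headD ht nil) (map (g := fun _ (l : List Name) => (l.headD [], l.tail))
    (takeWhile (p := fun _ (l : List Name) => !l.isEmpty) (tail ht) (not (isEmpty (snd id))))
    ((headD (snd id) nil).pair (tail (snd id))))

theorem dropQuery {t : γ → List (List Name)} (ht : PolyTime t) :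
    PolyTime fun c => dropQuery (t c) :=
  tail (dropWhile (p := fun _ (l : List Name) => !l.isEmpty) (tail ht) (not (isEmpty (snd id))))

end PolyTime

/-! ### The exponential time bound -/

namespace DistInput

/-- The length of the word on the input tape. -/
def len (x : DistInput) : ℕ := (encodeInput x).length

/-- An upper bound for the number of the candidates in all exhaustive searches. -/
def bound (x : DistInput) : ℕ := 2 ^ (6 * (x.len * x.len * x.len))

theorem meas_encodeInput (x : DistInput) : meas (encodeInput x).reverse ≤ 8 * x.len + 1 := by
  refine (meas_list_le (B := 7) fun _ _ => le_rfl).trans ?_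
  rw [List.length_reverse, mul_comm]
  exact le_rfl

/-- The measure is exponential in the length of the word, so polynomial in the measure means
exponential time. The word is reversed because `readInput` leaves it so. -/
instance : Dat DistInput where
  enc x := enc (encodeInput x).reverse
  meas x := 2 ^ (6 * (x.len * x.len * x.len) + 8 * x.len + 1)
  size_enc_le x := by
    refine (size_enc_le _).trans ((meas_encodeInput x).trans ?_)
    exact (Nat.lt_two_pow_self).le.trans (Nat.pow_le_pow_right (by norm_num) (by omega))

theorem polyTime_encodeInput : PolyTime encodeInput := by
  have : PolyTime fun x : DistInput => (encodeInput x).reverse :=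
    (PolyTime.id (α := DistInput)).of_enc (fun _ => rfl) (PolyBdd.meas_self.mono fun x =>
      (meas_encodeInput x).trans
        ((Nat.lt_two_pow_self).le.trans (Nat.pow_le_pow_right (by norm_num) (by omega))))
  exact this.reverse.of_eq fun x => List.reverse_reverse _

/-- The bound is obtained by repeated doubling in unary notation; the intermediate powers stay below
the measure of the input. -/
theorem polyTime_bound : PolyTime bound := by
  have hl : PolyTime len := polyTime_encodeInput.length
  refine PolyTime.iterate (F := fun _ m => 2 ^ m) (g := fun _ n => n + n)
    (PolyTime.mul (PolyTime.const 6) ((hl.mul hl).mul hl)) (PolyTime.const 1)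
    (PolyTime.add (PolyTime.snd PolyTime.id) (PolyTime.snd PolyTime.id))
    (fun _ m => by rw [pow_succ]; ring) (B := fun x => 2 * meas x + 1)
    (((PolyBdd.const 2).mul PolyBdd.meas_self).add (PolyBdd.const 1)) fun x m hm => ?_
  rw [meas_nat]
  refine Nat.add_le_add_right (Nat.mul_le_mul_left 2 ?_) 1
  exact Nat.pow_le_pow_right (by norm_num) (by omega)

/-- The queries considered for an input: the given ones and all queries with few variables. -/
def candidates (x : DistInput) : List RawQuery :=
  x.Q₁.1.raw :: x.Q₂.1.raw :: RawQuery.queries x.bound x.σ.unaryArities x.α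

/-- The distance of the queries of an input as computed by exhaustive search. -/
def dist (x : DistInput) : ℕ :=
  RawQuery.dist x.bound x.candidates x.Q₁.1.raw x.Q₂.1.raw

theorem polyTime_encodeNat_dist : PolyTime fun x : DistInput => Computability.encodeNat x.dist := by
  have ht := PolyTime.parse.comp polyTime_encodeInput
  have hars : PolyTime fun x : DistInput => x.σ.unaryArities :=
    (PolyTime.headD ht PolyTime.nil).of_eq fun x => by rw [parse_encodeInput]; rfl
  have h1 : PolyTime fun x : DistInput => x.Q₁.1.raw :=
    (PolyTime.takeQuery ht.tail).of_eq fun x => by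
      rw [parse_encodeInput, List.append_assoc]
      exact takeQuery_eq _ _
  have h2 : PolyTime fun x : DistInput => x.Q₂.1.raw :=
    (PolyTime.takeQuery (PolyTime.dropQuery ht.tail)).of_eq fun x => by
      rw [parse_encodeInput, List.append_assoc]
      exact (congrArg _ (dropQuery_eq _ _)).trans (takeQuery_eq _ [])
  have hα : PolyTime fun x : DistInput => x.α :=
    (PolyTime.length (PolyTime.fst h1)).of_eq fun x => by simp [CQ.raw]
  exact PolyTime.encodeNat_dist polyTime_bound
    (PolyTime.cons h1 (PolyTime.cons h2 (PolyTime.queries polyTime_bound hars hα))) h1 h2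

/-- The exhaustive search is carried out by a Turing machine in exponential time. -/
theorem exists_computableInTime :
    ∃ (M : Turing.TM2ComputableInTime encodeInput Computability.encodeNat dist)
      (p : Polynomial ℕ), ∀ n : ℕ, M.time n ≤ 2 ^ p.eval n := by
  -- The output is reversed since `writeOutput` reverses it again; `k` is the exponent for the cost
  -- and `j` that for the length of the output.
  obtain ⟨c, hc, ⟨k, hk⟩, j, hj⟩ := polyTime_encodeNat_dist.reverse
  obtain ⟨M, hM⟩ := Code.exists_computableInTime encodeInput Computability.encodeNat dist c
    (fun n => (2 ^ (6 * (n * n * n) + 8 * n + 1) + 2) ^ (k + j)) hc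
    (fun x => (hk x).trans (Nat.pow_le_pow_right (by omega) (Nat.le_add_right _ _)))
    (fun x => by
      refine le_trans ?_ ((hj x).trans (Nat.pow_le_pow_right (by omega) (Nat.le_add_left _ _)))
      change _ ≤ meas (Computability.encodeNat x.dist).reverse
      rw [meas_bits, List.length_reverse]
      omega)
  -- In the exponent, 3 instead of 1 absorbs the offset 2 of the base, and `36 * X + 20` absorbs the
  -- factor 20 and the terms `36 * n + 14` of the time of `M`.
  refine ⟨M, (6 * (Polynomial.X * Polynomial.X * Polynomial.X) + 8 * Polynomial.X + 3) *
    Polynomial.C (k + j) + 36 * Polynomial.X + 20, fun n => ?_⟩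
  have h1 : (2 ^ (6 * (n * n * n) + 8 * n + 1) + 2) ^ (k + j) ≤
      2 ^ ((6 * (n * n * n) + 8 * n + 3) * (k + j)) := by
    rw [pow_mul]
    refine Nat.pow_le_pow_left ?_ _
    have : 2 ^ (6 * (n * n * n) + 8 * n + 1) ≥ 2 :=
      le_self_pow₀ (by norm_num) (by omega) |>.trans' le_rfl
    rw [pow_succ 2 (_ + 2), pow_succ 2 (_ + 1)]
    omega
  have h2 : 36 * n < 2 ^ (36 * n) := Nat.lt_two_pow_self
  have h3 : 1 ≤ 2 ^ ((6 * (n * n * n) + 8 * n + 3) * (k + j)) := Nat.one_le_two_pow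
  have h6 : (2 : ℕ) ^ 20 = 1048576 := by norm_num
  rw [hM]
  beta_reduce
  simp only [Polynomial.eval_add, Polynomial.eval_mul, Polynomial.eval_X, Polynomial.eval_C,
    Polynomial.eval_ofNat]
  rw [pow_add 2 _ 20, pow_add 2 _ (36 * n), h6]
  generalize 2 ^ ((6 * (n * n * n) + 8 * n + 3) * (k + j)) = a at h1 h3 ⊢
  generalize 2 ^ (36 * n) = d at h2 ⊢
  have h4 : a ≤ a * d := Nat.le_mul_of_pos_right a (by omega)
  have h5 : d ≤ a * d := Nat.le_mul_of_pos_left d (by omega)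
  omega

end DistInput

/-! ### Containment and homomorphisms -/

namespace CQ

variable {σ : Schema} {α : ℕ}

theorem Contained.refl (Q : CQ σ α) : Q.Contained Q := fun _ => subset_rfl

theorem Contained.trans {Q₁ Q₂ Q₃ : CQ σ α} (h : Q₁.Contained Q₂) (h' : Q₂.Contained Q₃) :
    Q₁.Contained Q₃ := fun I => (h I).trans (h' I)

/-- `h` is a homomorphism from `Q₂` to `Q₁`. -/
def IsHom (Q₂ Q₁ : CQ σ α) (h : Var → Var) : Prop :=
  (∀ A ∈ Q₂.body, A.map h ∈ Q₁.body) ∧ ∀ i, h (Q₂.head i) = Q₁.head i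

/-- The homomorphism theorem of Chandra and Merlin. -/
theorem contained_iff (Q₁ Q₂ : CQ σ α) : Q₁.Contained Q₂ ↔ ∃ h, Q₂.IsHom Q₁ h := by
  classical
  constructor
  · intro H
    -- Variables and constants are the same numbers, so the body of `Q₁` is itself an instance, the
    -- canonical one, and the identity embeds `Q₁` in it.
    obtain ⟨h, hh, e⟩ := H Q₁.body.toFinset
      ⟨_root_.id, fun A hA => List.mem_toFinset.2 hA, rfl⟩
    exact ⟨h, fun A hA => List.mem_toFinset.1 (hh A hA), fun i => (congrFun e i).symm⟩
  · rintro ⟨h, hb, hh⟩ I t ⟨g, hg, rfl⟩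
    exact ⟨g ∘ h, fun A hA => hg _ (hb A hA), funext fun i => congrArg g (hh i).symm⟩

end CQ

/-! ### Correctness of the containment test -/

theorem encodeNat_injective : Function.Injective Computability.encodeNat :=
  Function.LeftInverse.injective Computability.decode_encodeNat

theorem Atom.raw_injective {σ : Schema} : Function.Injective (Atom.raw (σ := σ)) := by
  rintro ⟨r, f⟩ ⟨r', f'⟩ h
  obtain rfl : r = r' := Fin.ext (encodeNat_injective (congrArg Prod.fst h))
  obtain rfl : f = f' := List.ofFn_injective
    (List.map_injective_iff.2 encodeNat_injective (congrArg Prod.snd h))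
  rfl

section Tuples

variable {β : Type} {b : ℕ} {L : List β} {m : ℕ}

theorem length_tuples_le_pow (b : ℕ) (L : List β) (m : ℕ) :
    (tuples b L m).length ≤ L.length ^ m := by
  induction m with
  | zero => simp [tuples]
  | succ m ih =>
    rw [tuples, List.length_take, List.length_flatMap]
    refine (min_le_right _ _).trans ?_
    simp only [List.length_map, List.map_const', List.sum_replicate, smul_eq_mul]
    rw [pow_succ]
    exact Nat.mul_le_mul_right _ ih

/-- If there is a tuple of positive length, `L` is not empty and its powers increase with the
exponent; so lists of shorter tuples are not cut off either. -/
theorem mem_tuples_iff (h : L.length ^ m ≤ b) {t : List β} :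
    t ∈ tuples b L m ↔ t.length = m ∧ ∀ x ∈ t, x ∈ L := by
  refine ⟨mem_of_mem_tuples, ?_⟩
  induction m generalizing t with
  | zero =>
    rintro ⟨h, -⟩
    simpa [tuples] using h
  | succ m ih =>
    rintro ⟨h1, h2⟩
    obtain ⟨x, t, rfl⟩ := List.exists_cons_of_length_eq_add_one h1
    have hx : x ∈ L := h2 x (by simp)
    have hL : 0 < L.length := List.length_pos_of_mem hx
    have hm : L.length ^ m ≤ b := (Nat.pow_le_pow_right hL (Nat.le_succ m)).trans h
    rw [tuples, List.take_of_length_le]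
    · refine List.mem_flatMap.2 ⟨t, ih hm ⟨by simpa using h1, fun y hy => h2 y (by simp [hy])⟩, ?_⟩
      exact List.mem_map.2 ⟨x, hx, rfl⟩
    · rw [List.length_flatMap]
      simp only [List.length_map, List.map_const', List.sum_replicate, smul_eq_mul]
      refine le_trans ?_ h
      rw [pow_succ]
      exact Nat.mul_le_mul_right _ (length_tuples_le_pow b L m)

end Tuples

namespace RawQuery

theorem isFunctional_iff (l : List (Name × Name)) :
    isFunctional l = true ↔ ∃ H : Name → Name, ∀ p ∈ l, p.2 = H p.1 := by
  simp only [isFunctional, List.all_eq_true, Bool.or_eq_true, Bool.not_eq_true', beq_iff_eq,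
    beq_eq_false_iff_ne]
  constructor
  · intro h
    classical
    refine ⟨fun x => if hx : ∃ y, (x, y) ∈ l then hx.choose else [], fun p hp => ?_⟩
    have hx : ∃ y, (p.1, y) ∈ l := ⟨p.2, hp⟩
    beta_reduce
    rw [dif_pos hx]
    exact (h p hp _ hx.choose_spec).resolve_left fun hne => hne rfl
  · rintro ⟨H, hH⟩ p hp q hq
    by_cases h : p.1 = q.1
    · exact .inr (by rw [hH p hp, hH q hq, h])
    · exact .inl h

/-- A homomorphism amounts to a choice of an atom of `Q₁` for each atom of `Q₂` such that relation
names agree and the resulting pairs of variables, with those of the heads, form a function. The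
hypothesis ensures that all choices are tried. -/
theorem le_raw {σ : Schema} {α : ℕ} {Q₁ Q₂ : CQ σ α} {b : ℕ}
    (h : Q₁.body.length ^ Q₂.body.length ≤ b) :
    le b Q₁.raw Q₂.raw = true ↔ Q₁.Contained Q₂ := by
  rw [CQ.contained_iff, le, List.any_eq_true]
  have hlen : ∀ Q : CQ σ α, Q.raw.2.length = Q.body.length := fun Q => by simp [CQ.raw]
  have hmem : ∀ t, t ∈ tuples b Q₁.raw.2 Q₂.raw.2.length ↔ _ := fun t =>
    mem_tuples_iff (by rw [hlen, hlen]; exact h)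
  simp only [hmem]
  constructor
  · rintro ⟨d, ⟨hd, hd'⟩, hm⟩
    obtain ⟨D, rfl⟩ : d ∈ Set.range (List.map Atom.raw) := by
      rw [Set.range_list_map]
      intro A hA
      obtain ⟨A', -, e⟩ := List.mem_map.1 (hd' A hA)
      exact ⟨A', e⟩
    rw [isMatch, Bool.and_eq_true, isFunctional_iff] at hm
    obtain ⟨hrel, H, hH⟩ := hm
    -- The function `H` on names is transported to variables; on the variables of `Q₂` its values
    -- are numerals.
    refine ⟨fun n => Computability.decodeNat (H (Computability.encodeNat n)), fun A hA => ?_,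
      fun i => ?_⟩
    · obtain ⟨k, hk, rfl⟩ := List.getElem_of_mem hA
      have hkD : k < D.length := by
        rw [List.length_map, hlen] at hd
        rwa [hd]
      have hz : (Q₂.body[k].raw, D[k].raw) ∈ Q₂.raw.2.zip (D.map Atom.raw) := by
        refine List.mem_iff_getElem.2 ⟨k, by simp [CQ.raw, hk, hkD], ?_⟩
        simp [CQ.raw]
      have h1 : Q₂.body[k].raw.1 = D[k].raw.1 := by
        simpa using List.all_eq_true.1 hrel _ hz
      have h2 : Q₂.body[k].rel = D[k].rel := Fin.ext (encodeNat_injective h1)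
      have h3 : D[k] ∈ Q₁.body := by
        obtain ⟨A', hA', e⟩ := List.mem_map.1 (hd' D[k].raw
          (List.mem_map_of_mem (List.getElem_mem hkD)))
        rwa [← Atom.raw_injective e]
      have h4 : ∀ p ∈ Q₂.body[k].raw.2.zip D[k].raw.2, p.2 = H p.1 := fun p hp =>
        hH p (List.mem_append_right _ (List.mem_flatMap.2 ⟨_, hz, hp⟩))
      convert h3
      generalize Q₂.body[k] = A at *
      generalize D[k] = C at *
      obtain ⟨r, f⟩ := A
      obtain ⟨r', g⟩ := C
      obtain rfl : r = r' := h2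
      unfold Atom.map
      congr 1
      funext j
      have := h4 (Computability.encodeNat (f j), Computability.encodeNat (g j))
        (List.mem_iff_getElem.2 ⟨j, by simp [Atom.raw], by simp [Atom.raw]⟩)
      dsimp only at this ⊢
      rw [← this, Computability.decode_encodeNat]
    · have := hH (Computability.encodeNat (Q₂.head i), Computability.encodeNat (Q₁.head i))
        (List.mem_append_left _ (List.mem_iff_getElem.2
          ⟨i, by simp [CQ.raw], by simp [CQ.raw]⟩))
      dsimp only at this ⊢
      rw [← this, Computability.decode_encodeNat]
  · rintro ⟨h, hbody, hhead⟩
    refine ⟨Q₂.body.map fun A => (A.map h).raw, ⟨by simp [CQ.raw], ?_⟩, ?_⟩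
    · intro A hA
      obtain ⟨A', hA', rfl⟩ := List.mem_map.1 hA
      exact List.mem_map_of_mem (hbody A' hA')
    · have hzip : Q₂.raw.2.zip (Q₂.body.map fun A => (A.map h).raw) =
          Q₂.body.map fun A => (A.raw, (A.map h).raw) := by
        rw [CQ.raw, List.zip_map']
      rw [isMatch, Bool.and_eq_true, isFunctional_iff, hzip]
      refine ⟨by simp [Atom.raw, Atom.map], fun x =>
        Computability.encodeNat (h (Computability.decodeNat x)), fun p hp => ?_⟩
      rcases List.mem_append.1 hp with hp | hp
      · obtain ⟨k, hk, rfl⟩ := List.mem_iff_getElem.1 hp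
        simp [CQ.raw, hhead]
      · obtain ⟨q, hq, hp⟩ := List.mem_flatMap.1 hp
        obtain ⟨A, hA, rfl⟩ := List.mem_map.1 hq
        obtain ⟨k, hk, rfl⟩ := List.mem_iff_getElem.1 hp
        simp [Atom.raw, Atom.map]

end RawQuery

/-! ### The distance as a graph distance between equivalence classes -/

/-- Used for intervals of queries, which shrink, and for sets of reached queries, which grow; the
list `L` of representatives makes both counts finite. -/
theorem countP_lt_countP {β : Type} {p q : β → Prop} [DecidablePred p] [DecidablePred q]
    {L : List β} (hpq : ∀ x, p x → q x) (hx : ∃ x ∈ L, q x ∧ ¬ p x) :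
    L.countP (fun x => decide (p x)) < L.countP fun x => decide (q x) := by
  induction L with
  | nil => simp at hx
  | cons a L ih =>
    have hle : L.countP (fun x => decide (p x)) ≤ L.countP (fun x => decide (q x)) :=
      List.countP_mono_left fun x _ => by simpa using hpq x
    rw [List.countP_cons, List.countP_cons]
    obtain ⟨x, hx, hq, hp⟩ := hx
    rcases List.mem_cons.1 hx with rfl | hx
    · simp only [hp, hq, decide_false, decide_true, if_true, Bool.false_eq_true, if_false]
      omega
    · have := ih ⟨x, hx, hq, hp⟩
      by_cases hpa : p a
      · have hqa := hpq a hpa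
        simp only [hpa, hqa]
        omega
      · simp only [hpa, decide_false, Bool.false_eq_true, if_false]
        omega

namespace CQ

variable {σ : Schema} {α : ℕ} {Q₁ Q₂ Q₃ : CQ σ α}

theorem Equivalent.refl (Q : CQ σ α) : Q.Equivalent Q := ⟨.refl Q, .refl Q⟩

theorem Equivalent.symm (h : Q₁.Equivalent Q₂) : Q₂.Equivalent Q₁ := ⟨h.2, h.1⟩

theorem Equivalent.trans (h : Q₁.Equivalent Q₂) (h' : Q₂.Equivalent Q₃) : Q₁.Equivalent Q₃ :=
  ⟨h.1.trans h'.1, h'.2.trans h.2⟩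

end CQ

namespace TwoCQ

variable {σ : Schema} {α : ℕ} {u u' v v' w : TwoCQ σ α}

/-- One of the two queries is maximally contained in the other one. -/
def Adjacent (u v : TwoCQ σ α) : Prop := u.MaxContained v ∨ v.MaxContained u

theorem Adjacent.symm (h : u.Adjacent v) : v.Adjacent u := Or.symm h

theorem Adjacent.not_equivalent (h : u.Adjacent v) : ¬ u.1.Equivalent v.1 := by
  rintro ⟨h1, h2⟩
  rcases h with h | h
  · exact h.2.1 h2
  · exact h.2.1 h1

theorem MaxContained.congr (h : u.MaxContained v) (hu : u.1.Equivalent u'.1)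
    (hv : v.1.Equivalent v'.1) : u'.MaxContained v' := by
  obtain ⟨h1, h2, h3⟩ := h
  refine ⟨hu.2.trans (h1.trans hv.1), fun h => h2 (hv.1.trans (h.trans hu.2)), fun w hw hw' => ?_⟩
  exact (h3 w (hu.1.trans hw) (hw'.trans hv.2)).imp (fun h => hu.symm.trans h)
    fun h => h.trans hv

theorem Adjacent.congr (h : u.Adjacent v) (hu : u.1.Equivalent u'.1)
    (hv : v.1.Equivalent v'.1) : u'.Adjacent v' :=
  h.imp (fun h => h.congr hu hv) fun h => h.congr hv hu

/-- Equivalent or adjacent queries. -/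
def Near (u v : TwoCQ σ α) : Prop := u.1.Equivalent v.1 ∨ u.Adjacent v

theorem Near.symm (h : u.Near v) : v.Near u := h.imp .symm .symm

theorem Near.congr (h : u.Near v) (hu : u.1.Equivalent u'.1) (hv : v.1.Equivalent v'.1) :
    u'.Near v' :=
  h.imp (fun h => hu.symm.trans (h.trans hv)) fun h => h.congr hu hv

/-- `v` is reached from `u` in at most `k` steps between adjacent queries. -/
def Reach (u : TwoCQ σ α) : ℕ → TwoCQ σ α → Prop
  | 0, v => u.1.Equivalent v.1
  | k + 1, v => ∃ w, Reach u k w ∧ w.Near v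

theorem Reach.congr {k : ℕ} (h : Reach u k v) (hv : v.1.Equivalent v'.1) : Reach u k v' := by
  cases k with
  | zero => exact CQ.Equivalent.trans h hv
  | succ k =>
    obtain ⟨w, hw, h⟩ := h
    exact ⟨w, hw, h.congr (.refl _) hv⟩

theorem Reach.succ {k : ℕ} (h : Reach u k v) : Reach u (k + 1) v := ⟨v, h, .inl (.refl _)⟩

theorem Reach.mono {k l : ℕ} (h : Reach u k v) (hl : k ≤ l) : Reach u l v := by
  induction hl with
  | refl => exact h
  | step _ ih => exact ih.succ

/-- `k` is the least number of steps in which `v` is reached from `u`. -/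
def Level (u : TwoCQ σ α) (k : ℕ) (v : TwoCQ σ α) : Prop :=
  Reach u k v ∧ ∀ j < k, ¬ Reach u j v

theorem Reach.exists_level {k : ℕ} (h : Reach u k v) : ∃ j ≤ k, Level u j v := by
  classical
  have h' : ∃ k, Reach u k v := ⟨k, h⟩
  exact ⟨Nat.find h', Nat.find_min' h' h, Nat.find_spec h', fun j hj => Nat.find_min h' hj⟩

theorem Level.unique {j k : ℕ} (hj : Level u j v) (hk : Level u k v) : j = k := by
  rcases lt_trichotomy j k with h | h | h
  · exact (hk.2 j h hj.1).elim
  · exact h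
  · exact (hj.2 k h hk.1).elim

/-- `Reach` permits idle steps, so `Level` is the usual distance on equivalence classes. In the
clause for `i + 2`, non-equivalence excludes arrival in 0 steps, and the absence of a neighbour at a
distance below `i + 1` excludes arrival in 1 to `i + 1` steps. -/
theorem isDist_iff_level (u : TwoCQ σ α) (i : ℕ) (v : TwoCQ σ α) : IsDist u i v ↔ Level u i v := by
  induction i using Nat.strong_induction_on generalizing v with
  | _ i ih =>
    match i with
    | 0 =>
      rw [IsDist]
      exact ⟨fun h => ⟨h, nofun⟩, fun h => h.1⟩
    | 1 =>
      rw [IsDist]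
      constructor
      · intro h
        refine ⟨⟨u, .refl _, .inr h⟩, fun j hj => ?_⟩
        obtain rfl : j = 0 := by omega
        exact Adjacent.not_equivalent h
      · rintro ⟨⟨w, hw, h⟩, h'⟩
        refine (h.congr (CQ.Equivalent.symm hw) (.refl _)).resolve_left (h' 0 (by omega))
    | i + 2 =>
      rw [IsDist]
      constructor
      · rintro ⟨h0, ⟨w, hw, hvw⟩, hmin⟩
        rw [ih _ (by omega)] at hw
        refine ⟨⟨w, hw.1, .inr (Adjacent.symm hvw)⟩, fun j hj hr => ?_⟩
        -- At the earliest arrival the last step is not idle, so it comes from a neighbour that is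
        -- too close to `u`.
        obtain ⟨k, hk, hr, hr'⟩ := hr.exists_level
        match k with
        | 0 => exact h0 hr
        | k + 1 =>
          obtain ⟨z, hz, h | h⟩ := hr
          · exact hr' k (by omega) (hz.congr h)
          · obtain ⟨l, hl, hl'⟩ := hz.exists_level
            exact hmin ⟨l, by omega, z, (ih l (by omega) z).2 hl', h.symm⟩
      · rintro ⟨⟨w, hw, h⟩, hmin⟩
        have h : w.Adjacent v := h.resolve_left fun h => hmin (i + 1) (by omega) (hw.congr h)
        refine ⟨hmin 0 (by omega), ⟨w, (ih _ (by omega) w).2 ⟨hw, fun j hj hr => ?_⟩, h.symm⟩, ?_⟩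
        · exact hmin (j + 1) (by omega) ⟨w, hr, .inr h⟩
        · rintro ⟨j, hj, z, hz, hvz⟩
          exact hmin (j + 1) (by omega) ⟨z, ((ih j (by omega) z).1 hz).1, .inr (Adjacent.symm hvz)⟩

/-- There is a query that is contained in all others. -/
theorem exists_bottom (u : TwoCQ σ α) : ∃ b : TwoCQ σ α, ∀ v : TwoCQ σ α, b.1.Contained v.1 := by
  have hbody : ∀ r : Fin σ.numRel,
      (⟨r, fun _ => 0⟩ : Atom σ Var) ∈ (List.finRange σ.numRel).map fun r => ⟨r, fun _ => 0⟩ :=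
    fun r => List.mem_map_of_mem (List.mem_finRange r)
  -- With one atom `R(0, …, 0)` for each `R`, the constant map is a homomorphism from every query.
  refine ⟨⟨⟨fun _ => 0, (List.finRange σ.numRel).map fun r => ⟨r, fun _ => 0⟩, ?_, fun i => ?_⟩,
    fun R => ?_⟩, fun v => ?_⟩
  -- The query `u` shows that there is a relation name and, if the head is not empty, one of
  -- positive arity.
  · obtain ⟨A, hA⟩ := List.exists_mem_of_ne_nil _ u.1.body_ne_nil
    exact List.ne_nil_of_mem (hbody A.rel)
  · obtain ⟨A, -, j, -⟩ := u.1.head_subset i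
    exact ⟨_, hbody A.rel, j, rfl⟩
  · dsimp only
    rw [List.map_map]
    refine le_trans (le_of_eq ?_) (List.nodup_iff_count_le_one.1 (List.nodup_finRange σ.numRel) R
      |>.trans one_le_two)
    exact congrArg _ (List.map_id _)
  · rw [CQ.contained_iff]
    exact ⟨fun _ => 0, fun A _ => hbody A.rel, fun _ => rfl⟩

section Finite

variable {L : List (TwoCQ σ α)} (hL : ∀ v : TwoCQ σ α, ∃ w ∈ L, v.1.Equivalent w.1)

include hL

/-- Induction on the number of representatives between `u` and `v`. If neither equivalence nor
maximal containment holds, some `w` lies strictly between; the interval below `w` loses the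
representative of `v`, and the one above loses that of `u`. -/
theorem reflTransGen_of_contained (u v : TwoCQ σ α) (h : u.1.Contained v.1) :
    Relation.ReflTransGen Near u v := by
  classical
  obtain ⟨n, hn⟩ : ∃ n, L.countP (fun w => decide (u.1.Contained w.1 ∧ w.1.Contained v.1)) ≤ n :=
    ⟨_, le_rfl⟩
  induction n using Nat.strong_induction_on generalizing u v with
  | _ n ih =>
    by_cases h' : v.1.Contained u.1
    · exact .single (.inl ⟨h, h'⟩)
    by_cases hm : u.MaxContained v
    · exact .single (.inr (.inl hm))
    obtain ⟨w, huw, hwv, h1, h2⟩ : ∃ w : TwoCQ σ α, u.1.Contained w.1 ∧ w.1.Contained v.1 ∧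
        ¬ u.1.Equivalent w.1 ∧ ¬ w.1.Equivalent v.1 := by
      by_contra hw
      refine hm ⟨h, h', fun w huw hwv => ?_⟩
      by_contra hne
      rw [not_or] at hne
      exact hw ⟨w, huw, hwv, hne.1, hne.2⟩
    refine Relation.ReflTransGen.trans (ih _ ?_ u w huw le_rfl) (ih _ ?_ w v hwv le_rfl)
    · refine (countP_lt_countP (p := fun x : TwoCQ σ α => u.1.Contained x.1 ∧ x.1.Contained w.1)
        (q := fun x : TwoCQ σ α => u.1.Contained x.1 ∧ x.1.Contained v.1)
        (fun x hx => ⟨hx.1, hx.2.trans hwv⟩) ?_).trans_le hn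
      obtain ⟨v', hv', e⟩ := hL v
      exact ⟨v', hv', ⟨h.trans e.1, e.2⟩, fun hx => h2 ⟨hwv, e.1.trans hx.2⟩⟩
    · refine (countP_lt_countP (p := fun x : TwoCQ σ α => w.1.Contained x.1 ∧ x.1.Contained v.1)
        (q := fun x : TwoCQ σ α => u.1.Contained x.1 ∧ x.1.Contained v.1)
        (fun x hx => ⟨huw.trans hx.1, hx.2⟩) ?_).trans_le hn
      obtain ⟨u', hu', e⟩ := hL u
      exact ⟨u', hu', ⟨e.1, e.2.trans h⟩, fun hx => h1 ⟨huw, hx.1.trans e.2⟩⟩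

/-- The path descends from `u` to the bottom query and ascends from there to `v`. -/
theorem exists_reach (u v : TwoCQ σ α) : ∃ k, Reach u k v := by
  obtain ⟨b, hb⟩ := exists_bottom u
  have h : Relation.ReflTransGen Near u v :=
    (Relation.ReflTransGen.mono (fun _ _ h => Near.symm h) _ _
      (reflTransGen_of_contained hL b u (hb u)).swap).trans
      (reflTransGen_of_contained hL b v (hb v))
  induction h with
  | refl => exact ⟨0, .refl _⟩
  | tail _ h ih =>
    obtain ⟨k, hk⟩ := ih
    exact ⟨k + 1, _, hk, h⟩

/-- Every query is reached from every other one in at most as many steps as there are queries up to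
equivalence. -/
theorem reach_length (u v : TwoCQ σ α) : Reach u L.length v := by
  classical
  by_contra hv
  -- As long as `v` is missing, every step reaches a new representative: otherwise the reached set
  -- would be stable and, by connectedness, contain `v`. After `L.length` steps there would be too
  -- many.
  have key : ∀ j ≤ L.length, j + 1 ≤ L.countP fun w => decide (Reach u j w) := by
    intro j hj
    induction j with
    | zero =>
      obtain ⟨w, hw, e⟩ := hL u
      exact List.countP_pos_iff.2 ⟨w, hw, decide_eq_true (show Reach u 0 w from e)⟩
    | succ j ih =>
      refine Nat.succ_le_of_lt ((ih (by omega)).trans_lt ?_)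
      by_contra hc
      have hstable : ∀ w, Reach u (j + 1) w → Reach u j w := by
        have hL' : ∀ w ∈ L, Reach u (j + 1) w → Reach u j w := by
          intro w hw h
          by_contra hn
          exact hc (countP_lt_countP (p := Reach u j) (q := Reach u (j + 1))
            (fun _ h => h.succ) ⟨w, hw, h, hn⟩)
        intro w hw
        obtain ⟨w', hw', e⟩ := hL w
        exact (hL' w' hw' (hw.congr e)).congr e.symm
      have hall : ∀ k, ∀ w, Reach u (j + k) w → Reach u j w := by
        intro k
        induction k with
        | zero => exact fun _ h => h
        | succ k ihk =>
          rintro w ⟨z, hz, h⟩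
          exact hstable w ⟨z, ihk z hz, h⟩
      obtain ⟨k, hk⟩ := exists_reach hL u v
      exact hv ((hall k v (hk.mono (by omega))).mono (by omega))
  have := key L.length le_rfl
  have := List.countP_le_length (p := fun w => decide (Reach u L.length w)) (l := L)
  omega

end Finite

end TwoCQ

/-! ### Correctness of the breadth-first search -/

namespace RawQuery

open TwoCQ

variable {σ : Schema} {α b : ℕ} {L : List (TwoCQ σ α)}

section

variable (hle : ∀ a ∈ L, ∀ c ∈ L, le b a.1.raw c.1.raw = true ↔ a.1.Contained c.1)

include hle

theorem equiv_raw {a c : TwoCQ σ α} (ha : a ∈ L) (hc : c ∈ L) :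
    equiv b a.1.raw c.1.raw = true ↔ a.1.Equivalent c.1 := by
  rw [equiv, Bool.and_eq_true, hle a ha c hc, hle c hc a ha]
  rfl

variable (hL : ∀ v : TwoCQ σ α, ∃ w ∈ L, v.1.Equivalent w.1)

include hL

/-- Containment respects equivalence, so an intermediate query may be replaced by its representative
in `L`. -/
theorem maxLe_raw {a c : TwoCQ σ α} (ha : a ∈ L) (hc : c ∈ L) :
    maxLe b (L.map fun w => w.1.raw) a.1.raw c.1.raw = true ↔ a.MaxContained c := by
  have h : ∀ w ∈ L, (!(le b a.1.raw w.1.raw && le b w.1.raw c.1.raw) ||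
      (equiv b a.1.raw w.1.raw || equiv b w.1.raw c.1.raw)) = true ↔
      (a.1.Contained w.1 → w.1.Contained c.1 → a.1.Equivalent w.1 ∨ w.1.Equivalent c.1) := by
    intro w hw
    rw [Bool.or_eq_true, Bool.or_eq_true, equiv_raw hle ha hw, equiv_raw hle hw hc,
      Bool.not_eq_true', ← Bool.not_eq_true, Bool.and_eq_true, hle a ha w hw, hle w hw c hc]
    tauto
  rw [maxLe, Bool.and_eq_true, Bool.and_eq_true, hle a ha c hc, Bool.not_eq_true',
    ← Bool.not_eq_true, hle c hc a ha, List.all_map, List.all_eq_true, and_assoc]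
  refine and_congr_right fun _ => and_congr_right fun _ => ⟨fun H w h1 h2 => ?_, fun H w hw => ?_⟩
  · obtain ⟨w', hw', e⟩ := hL w
    exact ((h w' hw').1 (H w' hw') (h1.trans e.1) (e.2.trans h2)).imp
      (fun h => h.trans e.symm) fun h => e.trans h
  · exact (h w hw).2 (H w)

theorem near_raw {a c : TwoCQ σ α} (ha : a ∈ L) (hc : c ∈ L) :
    near b (L.map fun w => w.1.raw) a.1.raw c.1.raw = true ↔ a.Near c := by
  rw [near, Bool.or_eq_true, Bool.or_eq_true, equiv_raw hle ha hc, maxLe_raw hle hL ha hc,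
    maxLe_raw hle hL hc ha]
  rfl

/-- Breadth-first search computes the distance. -/
theorem level_dist {u v : TwoCQ σ α} (hu : u ∈ L) (hv : v ∈ L) :
    Level u (dist b (L.map fun w => w.1.raw) u.1.raw v.1.raw) v := by
  -- After `m` rounds, either `v` has been found and the counter is frozen at its level, or `S`
  -- represents all that is reached in at most `m` steps and `v` is not reached in fewer than `m`.
  let Inv (m : ℕ) (s : List RawQuery × ℕ) : Prop := ∃ S : List (TwoCQ σ α), S ⊆ L ∧
    s.1 = S.map (fun w => w.1.raw) ∧ ((∃ w ∈ S, w.1.Equivalent v.1) ∧ Level u s.2 v ∨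
      s.2 = m ∧ (∀ j < m, ¬ Reach u j v) ∧ ∀ a, Reach u m a ↔ ∃ w ∈ S, a.1.Equivalent w.1)
  have step : ∀ m s, Inv m s →
      Inv (m + 1) (searchStep b (L.map fun w => w.1.raw) v.1.raw s) := by
    rintro m ⟨T, d⟩ ⟨S, hS, hT, h⟩
    dsimp only at hT h
    subst hT
    have hany : (S.map fun w => w.1.raw).any (fun w => equiv b w v.1.raw) = true ↔
        ∃ w ∈ S, w.1.Equivalent v.1 := by
      rw [List.any_map, List.any_eq_true]
      exact exists_congr fun w => and_congr_right fun hw => equiv_raw hle (hS hw) hv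
    rw [searchStep]
    by_cases hex : ∃ w ∈ S, w.1.Equivalent v.1
    · rw [hany.2 hex, cond_true]
      refine ⟨S, hS, rfl, .inl ⟨hex, ?_⟩⟩
      rcases h with h | ⟨rfl, hj, hr⟩
      · exact h.2
      · obtain ⟨w, hw, e⟩ := hex
        exact ⟨(hr v).2 ⟨w, hw, e.symm⟩, hj⟩
    · obtain ⟨rfl, hj, hr⟩ := h.resolve_left fun h => hex h.1
      rw [Bool.eq_false_iff.2 fun h => hex (hany.1 h), cond_false]
      refine ⟨L.filter fun w => (S.map fun w => w.1.raw).any fun w' =>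
        near b (L.map fun w => w.1.raw) w' w.1.raw, fun _ h => (List.mem_filter.1 h).1, ?_, .inr ⟨rfl, ?_, ?_⟩⟩
      · dsimp only
        rw [List.filter_map]
        rfl
      · intro j hj' hjr
        rcases Nat.lt_succ_iff_lt_or_eq.1 hj' with hlt | rfl
        · exact hj j hlt hjr
        · obtain ⟨w, hw, e⟩ := (hr v).1 hjr
          exact hex ⟨w, hw, e.symm⟩
      · intro a
        have hmem : ∀ w, w ∈ L.filter (fun w => (S.map fun w => w.1.raw).any fun w' =>
            near b (L.map fun w => w.1.raw) w' w.1.raw) ↔ w ∈ L ∧ ∃ w' ∈ S, w'.Near w := by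
          intro w
          rw [List.mem_filter, List.any_map, List.any_eq_true]
          exact and_congr_right fun hw => exists_congr fun w' => and_congr_right fun hw' =>
            near_raw hle hL (hS hw') hw
        constructor
        · rintro ⟨w, hw, hn⟩
          obtain ⟨w', hw', e⟩ := (hr w).1 hw
          obtain ⟨a', ha', e'⟩ := hL a
          exact ⟨a', (hmem a').2 ⟨ha', w', hw', hn.congr e e'⟩, e'⟩
        · rintro ⟨w, hw, e⟩
          obtain ⟨-, w', hw', hn⟩ := (hmem w).1 hw
          exact ⟨w', (hr w').2 ⟨w', hw', .refl _⟩, hn.congr (.refl _) e.symm⟩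
  have key : ∀ (V : List RawQuery) m s, Inv m s → Inv (m + V.length)
      (V.foldl (fun s _ => searchStep b (L.map fun w => w.1.raw) v.1.raw s) s) := by
    intro V
    induction V with
    | nil => exact fun _ _ h => h
    | cons a V ih =>
      intro m s h
      rw [List.length_cons, add_comm V.length, ← add_assoc, List.foldl_cons]
      exact ih _ _ (step m s h)
  obtain ⟨S, -, -, h | ⟨h, hj, hr⟩⟩ := key (L.map fun w => w.1.raw) 0 ([u.1.raw], 0)
    ⟨[u], by simpa using hu, rfl, .inr ⟨rfl, nofun, fun a => by
      rw [Reach]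
      simp only [List.mem_singleton, exists_eq_left]
      exact ⟨fun h => h.symm, fun h => h.symm⟩⟩⟩
  · exact h.2
  -- If the search has not stopped, `v` is not reached in fewer than `L.length` steps, but it is
  -- reached in that many by `reach_length`.
  · rw [dist, h]
    refine ⟨?_, hj⟩
    rw [zero_add, List.length_map]
    exact reach_length hL u v

end

end RawQuery

/-! ### Enumeration of all queries up to equivalence -/

open Computability

theorem mem_names {x : Name} {n : ℕ} : x ∈ names n ↔ ∃ k < n, encodeNat k = x := by
  simp [names]

theorem length_names (n : ℕ) : (names n).length = n := by simp [names]

theorem mem_tuples_names {b n m : ℕ} (h : n ^ m ≤ b) {t : List Name} :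
    t ∈ tuples b (names n) m ↔
      ∃ f : Fin m → ℕ, (∀ j, f j < n) ∧ (List.ofFn f).map encodeNat = t := by
  rw [mem_tuples_iff (by rwa [length_names])]
  constructor
  · rintro ⟨rfl, ht⟩
    choose f hf e using fun j : Fin t.length => mem_names.1 (ht _ (List.getElem_mem j.2))
    refine ⟨f, hf, ?_⟩
    rw [List.map_ofFn]
    exact (congrArg List.ofFn (funext e)).trans List.ofFn_getElem
  · rintro ⟨f, hf, rfl⟩
    refine ⟨by simp, fun x hx => ?_⟩
    obtain ⟨k, hk, rfl⟩ := List.mem_map.1 hx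
    obtain ⟨j, rfl⟩ := (List.mem_ofFn' ..).1 hk
    exact mem_names.2 ⟨_, hf j, rfl⟩

namespace Schema

theorem length_unaryArities (σ : Schema) : σ.unaryArities.length = σ.numRel := by
  simp [unaryArities]

theorem length_flatten_unaryArities (σ : Schema) :
    σ.unaryArities.flatten.length = ∑ r, σ.arity r := by
  rw [List.length_flatten, unaryArities, List.map_map, ← List.sum_ofFn]
  congr 1
  simp [Function.comp_def]

theorem mem_zip_unaryArities {σ : Schema} {p : Name × Name} :
    p ∈ (names σ.unaryArities.length).zip σ.unaryArities ↔
      ∃ r : Fin σ.numRel, p = (encodeNat r, List.replicate (σ.arity r) true) := by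
  rw [length_unaryArities, List.mem_iff_getElem]
  constructor
  · rintro ⟨k, hk, rfl⟩
    have hk' : k < σ.numRel := by simpa [unaryArities, names] using hk
    exact ⟨⟨k, hk'⟩, by simp [unaryArities, names]⟩
  · rintro ⟨r, rfl⟩
    exact ⟨r, by simp [unaryArities, names], by simp [unaryArities, names]⟩

end Schema

namespace CQ

variable {σ : Schema} {α : ℕ}

/-- With `f = 1` this bounds the number of atoms, with `f = σ.arity` the number of occurrences of
variables. -/
theorem IsTwo.sum_le {Q : CQ σ α} (h : Q.IsTwo) (f : Fin σ.numRel → ℕ) :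
    (Q.body.map fun A => f A.rel).sum ≤ 2 * ∑ r, f r := by
  have : (Q.body.map fun A => f A.rel) = (Q.body.map Atom.rel).map f := by
    rw [List.map_map]
    rfl
  rw [this, Finset.sum_list_map_count, Finset.mul_sum]
  refine (Finset.sum_le_sum fun r _ => ?_).trans
    (Finset.sum_le_sum_of_subset (Finset.subset_univ _))
  exact Nat.mul_le_mul_right _ (h r)

theorem IsTwo.length_le {Q : CQ σ α} (h : Q.IsTwo) : Q.body.length ≤ 2 * σ.numRel := by
  simpa using h.sum_le fun _ => 1

/-- Every query is equivalent to one with few variables. -/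
theorem IsTwo.exists_equivalent {Q : CQ σ α} (h : Q.IsTwo) : ∃ Q' : CQ σ α, Q'.IsTwo ∧
    Q.Equivalent Q' ∧ ∀ A ∈ Q'.body, ∀ j, A.args j < 2 * ∑ r, σ.arity r := by
  -- Each variable is renamed to its first position in the list of all occurrences; looking up this
  -- position undoes the renaming.
  let vars := Q.body.flatMap fun A => List.ofFn A.args
  have hvars : ∀ A ∈ Q.body, ∀ j, A.args j ∈ vars := fun A hA j =>
    List.mem_flatMap.2 ⟨A, hA, List.mem_ofFn' _ _ |>.2 ⟨j, rfl⟩⟩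
  have hg : ∀ v ∈ vars, vars.getD (vars.idxOf v) 0 = v := fun v hv => by
    rw [List.getD_eq_getElem _ _ (List.idxOf_lt_length_iff.2 hv), List.getElem_idxOf]
  refine ⟨⟨fun i => vars.idxOf (Q.head i), Q.body.map (Atom.map fun v => vars.idxOf v), ?_, ?_⟩,
    ?_, ⟨?_, ?_⟩, ?_⟩
  · simpa using Q.body_ne_nil
  · intro i
    obtain ⟨A, hA, j, e⟩ := Q.head_subset i
    exact ⟨_, List.mem_map_of_mem hA, j, congrArg (fun v => vars.idxOf v) e⟩
  · intro R
    refine le_trans (le_of_eq ?_) (h R)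
    dsimp only
    rw [List.map_map]
    rfl
  · rw [contained_iff]
    refine ⟨fun n => vars.getD n 0, fun A hA => ?_, fun i => ?_⟩
    · obtain ⟨A, hA', rfl⟩ := List.mem_map.1 hA
      convert hA'
      unfold Atom.map
      obtain ⟨r, f⟩ := A
      congr 1
      funext j
      exact hg _ (hvars _ hA' j)
    · obtain ⟨A, hA, j, e⟩ := Q.head_subset i
      exact hg _ (e ▸ hvars A hA j)
  · rw [contained_iff]
    exact ⟨fun v => vars.idxOf v, fun A hA => List.mem_map_of_mem hA, fun _ => rfl⟩
  · intro A hA j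
    obtain ⟨A, hA', rfl⟩ := List.mem_map.1 hA
    refine (List.idxOf_lt_length_iff.2 (hvars A hA' j)).trans_le ?_
    rw [List.length_flatMap]
    simpa using h.sum_le σ.arity

end CQ

namespace RawQuery

variable {σ : Schema} {α b n : ℕ}

theorem mem_atoms (hb : ∀ r, n ^ σ.arity r ≤ b) {A : RawAtom} :
    A ∈ atoms b (names n) σ.unaryArities ↔
      ∃ A' : Atom σ Var, (∀ j, A'.args j < n) ∧ A'.raw = A := by
  simp only [atoms, List.mem_flatMap, Schema.mem_zip_unaryArities, List.mem_map]
  constructor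
  · rintro ⟨_, ⟨r, rfl⟩, t, ht, rfl⟩
    rw [List.length_replicate, mem_tuples_names (hb r)] at ht
    obtain ⟨f, hf, rfl⟩ := ht
    exact ⟨⟨r, f⟩, hf, rfl⟩
  · rintro ⟨⟨r, f⟩, hf, rfl⟩
    refine ⟨_, ⟨r, rfl⟩, _, ?_, rfl⟩
    rw [List.length_replicate, mem_tuples_names (hb r)]
    exact ⟨f, hf, rfl⟩

/-- The bound `c` is independent of the cut-off `b`: a power of the number of atoms still has to
stay below `b`. -/
theorem length_atoms_le {c : ℕ} (hc : ∀ r, n ^ σ.arity r ≤ c) :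
    (atoms b (names n) σ.unaryArities).length ≤ σ.numRel * c := by
  rw [atoms, List.length_flatMap]
  refine (List.sum_le_card_nsmul _ c fun k hk => ?_).trans ?_
  · obtain ⟨p, hp, rfl⟩ := List.mem_map.1 hk
    obtain ⟨r, rfl⟩ := Schema.mem_zip_unaryArities.1 hp
    rw [List.length_map, List.length_replicate]
    refine (length_tuples_le_pow _ _ _).trans ?_
    rw [length_names]
    exact hc r
  · simp [length_names, Schema.length_unaryArities]

theorem mem_bodies {A : List RawAtom} {m : ℕ} (hb : A.length ^ m ≤ b) {B : List RawAtom} :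
    B ∈ bodies b A m ↔ B ≠ [] ∧ B.length ≤ m ∧ ∀ x ∈ B, x ∈ A := by
  have h : ∀ k < m, A.length ^ (k + 1) ≤ b := fun k hk => by
    rcases Nat.eq_zero_or_pos A.length with h | h
    · rw [h, zero_pow (by omega)]
      exact Nat.zero_le _
    · exact (Nat.pow_le_pow_right h (by omega)).trans hb
  simp only [bodies, List.mem_flatMap, List.mem_range]
  constructor
  · rintro ⟨k, hk, hB⟩
    obtain ⟨h1, h2⟩ := mem_of_mem_tuples hB
    exact ⟨List.ne_nil_of_length_pos (by omega), by omega, h2⟩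
  · rintro ⟨h1, h2, h3⟩
    have := List.length_pos_of_ne_nil h1
    exact ⟨B.length - 1, by omega, (mem_tuples_iff (h _ (by omega))).2 ⟨by omega, h3⟩⟩

theorem isValid_iff (h : Fin α → Var) (B : List (Atom σ Var)) :
    isValid ((List.ofFn h).map encodeNat, B.map Atom.raw) = true ↔
      (∀ R, (B.map Atom.rel).count R ≤ 2) ∧ ∀ i, ∃ A ∈ B, ∃ j, A.args j = h i := by
  rw [isValid, Bool.and_eq_true]
  refine and_congr ?_ ?_
  · have hf : ∀ A : Atom σ Var, ((B.map Atom.raw).filter fun A' => A'.1 == A.raw.1).length =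
        (B.map Atom.rel).count A.rel := by
      intro A
      rw [List.filter_map, List.length_map, List.count, List.countP_map, List.countP_eq_length_filter]
      congr 2
      funext A'
      rw [Bool.eq_iff_iff]
      simp only [Function.comp_apply, beq_iff_eq]
      exact ⟨fun h => Fin.ext (encodeNat_injective h), fun h => congrArg (fun r : Fin σ.numRel => encodeNat r) h⟩
    have ht : ∀ A : Atom σ Var,
        ((B.map Atom.raw).filter fun A' => A'.1 == A.raw.1).tail.tail.isEmpty = true ↔
        (B.map Atom.rel).count A.rel ≤ 2 := by
      intro A
      rw [List.isEmpty_iff_length_eq_zero, List.length_tail, List.length_tail, hf]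
      omega
    rw [List.all_map, List.all_eq_true]
    constructor
    · intro H R
      by_cases hR : R ∈ B.map Atom.rel
      · obtain ⟨A, hA, rfl⟩ := List.mem_map.1 hR
        exact (ht A).1 (H A hA)
      · rw [List.count_eq_zero_of_not_mem hR]
        exact Nat.zero_le _
    · exact fun H A _ => (ht A).2 (H _)
  · simp only [List.all_map, List.all_eq_true, List.mem_ofFn, List.any_map, List.any_eq_true,
      Function.comp_apply, Atom.raw, beq_iff_eq, encodeNat_injective.eq_iff, forall_exists_index,
      forall_apply_eq_imp_iff, exists_exists_eq_and]

/-- The three hypotheses say that the enumerations of heads, of argument lists and of bodies are not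
cut off. -/
theorem mem_queries (hα : (2 * ∑ r, σ.arity r) ^ α ≤ b)
    (hr : ∀ r, (2 * ∑ r, σ.arity r) ^ σ.arity r ≤ b)
    (hA : (atoms b (names (2 * ∑ r, σ.arity r)) σ.unaryArities).length ^ (2 * σ.numRel) ≤ b)
    {q : RawQuery} : q ∈ queries b σ.unaryArities α ↔ ∃ Q : TwoCQ σ α,
      (∀ A ∈ Q.1.body, ∀ j, A.args j < 2 * ∑ r, σ.arity r) ∧ Q.1.raw = q := by
  rw [queries, List.mem_filter, List.mem_flatMap, Schema.length_flatten_unaryArities,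
    Schema.length_unaryArities]
  simp only [List.mem_map, mem_tuples_names hα, mem_bodies hA]
  constructor
  · rintro ⟨⟨_, ⟨f, hf, rfl⟩, B, ⟨h1, h2, h3⟩, rfl⟩, hv⟩
    obtain ⟨B, rfl⟩ : B ∈ Set.range (List.map fun A :
        {A : Atom σ Var // ∀ j, A.args j < 2 * ∑ r, σ.arity r} => A.1.raw) := by
      rw [Set.range_list_map]
      intro A hA
      obtain ⟨A', h, e⟩ := (mem_atoms hr).1 (h3 A hA)
      exact ⟨⟨A', h⟩, e⟩
    have hB : B.map (fun A => A.1.raw) = (B.map Subtype.val).map Atom.raw := by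
      rw [List.map_map]
      rfl
    rw [hB, isValid_iff] at hv
    refine ⟨⟨⟨f, B.map Subtype.val, by simpa using h1, hv.2⟩, hv.1⟩, fun A hA => ?_, ?_⟩
    · obtain ⟨A', -, rfl⟩ := List.mem_map.1 hA
      exact A'.2
    · exact congrArg (Prod.mk _) hB.symm
  · rintro ⟨⟨Q, hQ⟩, hlt, rfl⟩
    refine ⟨⟨_, ⟨Q.head, fun i => ?_, rfl⟩, Q.body.map Atom.raw, ⟨?_, ?_, fun A hA => ?_⟩, rfl⟩,
      (isValid_iff _ _).2 ⟨hQ, Q.head_subset⟩⟩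
    · obtain ⟨A, hA, j, e⟩ := Q.head_subset i
      exact e ▸ hlt A hA j
    · simpa using Q.body_ne_nil
    · simpa using hQ.length_le
    · obtain ⟨A, hA', rfl⟩ := List.mem_map.1 hA
      exact (mem_atoms hr).2 ⟨A, hlt A hA', rfl⟩

end RawQuery

/-! ### Size estimates in terms of the input length -/

namespace DistInput

variable (x : DistInput)

/-- Here the unary notation of the arities is used: every argument position and every relation name
takes up a symbol. -/
theorem numRel_add_sum_arity_le : x.σ.numRel + ∑ r, x.σ.arity r ≤ x.len := by
  have h : (encodeSchema x.σ).length = ∑ r, x.σ.arity r + x.σ.numRel + 1 := by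
    simp [encodeSchema, List.length_flatMap, Function.comp_def, List.sum_ofFn,
      Finset.sum_add_distrib]
  rw [len, encodeInput, List.length_append, List.length_append, h]
  omega

theorem length_encodeNumber_pos (n : ℕ) : 1 ≤ (encodeNumber n).length := by
  simp [encodeNumber]

theorem α_le : x.α ≤ x.len := by
  have h : x.α ≤ ((List.ofFn x.Q₁.1.head).flatMap encodeNumber).length := by
    rw [List.length_flatMap]
    refine le_trans (le_of_eq ?_) (List.card_nsmul_le_sum _ 1 fun k hk => ?_)
    · simp
    · obtain ⟨n, -, rfl⟩ := List.mem_map.1 hk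
      exact length_encodeNumber_pos n
  simp only [len, encodeInput, encodeQuery, List.length_append]
  omega

theorem pow_le_two_pow (a m : ℕ) : a ^ m ≤ 2 ^ (a * m) := by
  rw [pow_mul]
  exact Nat.pow_le_pow_left Nat.lt_two_pow_self.le m

/-- The number of variables considered, to a small power. -/
theorem pow_variables_le {m : ℕ} (h : m ≤ x.len) :
    (2 * ∑ r, x.σ.arity r) ^ m ≤ 2 ^ (2 * (x.len * x.len)) := by
  refine (pow_le_two_pow _ _).trans (Nat.pow_le_pow_right two_pos ?_)
  have := x.numRel_add_sum_arity_le
  rw [mul_assoc]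
  exact Nat.mul_le_mul_left 2 (Nat.mul_le_mul (by omega) h)

theorem pow_variables_arity_le (r : Fin x.σ.numRel) :
    (2 * ∑ r, x.σ.arity r) ^ x.σ.arity r ≤ 2 ^ (2 * (x.len * x.len)) := by
  refine x.pow_variables_le ?_
  have := x.numRel_add_sum_arity_le
  have := Finset.single_le_sum (f := x.σ.arity) (fun _ _ => Nat.zero_le _) (Finset.mem_univ r)
  omega

theorem two_pow_le_bound {m : ℕ} (h : m ≤ 6 * (x.len * x.len * x.len)) : 2 ^ m ≤ x.bound :=
  Nat.pow_le_pow_right two_pos h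

theorem sq_len_le : x.len * x.len ≤ x.len * x.len * x.len := by
  rcases Nat.eq_zero_or_pos x.len with h | h
  · simp [h]
  · exact Nat.le_mul_of_pos_right _ h

/-- With `n = x.len`, there are at most `2 ^ n²` relation names with `2 ^ (2 * n²)` argument lists
each, so `2 ^ (3 * n²)` atoms. The power `2 * numRel ≤ 2 * n` gives the exponent `6 * n³` of
`bound`. -/
theorem pow_length_atoms_le :
    (RawQuery.atoms x.bound (names (2 * ∑ r, x.σ.arity r)) x.σ.unaryArities).length ^
      (2 * x.σ.numRel) ≤ x.bound := by
  have h := x.numRel_add_sum_arity_le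
  have hlen : (RawQuery.atoms x.bound (names (2 * ∑ r, x.σ.arity r)) x.σ.unaryArities).length ≤
      2 ^ (3 * (x.len * x.len)) := by
    refine (RawQuery.length_atoms_le x.pow_variables_arity_le).trans ?_
    have h1 : x.σ.numRel ≤ 2 ^ (x.len * x.len) :=
      (show _ ≤ x.len by omega).trans ((Nat.le_mul_self _).trans Nat.lt_two_pow_self.le)
    refine (Nat.mul_le_mul_right _ h1).trans (le_of_eq ?_)
    rw [← pow_add]
    congr 1
    omega
  refine (Nat.pow_le_pow_left hlen _).trans ?_
  rw [← pow_mul]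
  refine x.two_pow_le_bound ?_
  calc 3 * (x.len * x.len) * (2 * x.σ.numRel) ≤ 3 * (x.len * x.len) * (2 * x.len) :=
        Nat.mul_le_mul_left _ (by omega)
    _ = 6 * (x.len * x.len * x.len) := by ring

theorem pow_length_body_le (Q Q' : TwoCQ x.σ x.α) :
    Q.1.body.length ^ Q'.1.body.length ≤ x.bound := by
  have h := x.numRel_add_sum_arity_le
  have h1 := Q.2.length_le
  have h2 := Q'.2.length_le
  refine (pow_le_two_pow _ _).trans (x.two_pow_le_bound ?_)
  calc Q.1.body.length * Q'.1.body.length ≤ (2 * x.len) * (2 * x.len) :=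
        Nat.mul_le_mul (by omega) (by omega)
    _ = 4 * (x.len * x.len) := by ring
    _ ≤ _ := by have := x.sq_len_le; omega

theorem mem_queries {q : RawQuery} :
    q ∈ RawQuery.queries x.bound x.σ.unaryArities x.α ↔ ∃ Q : TwoCQ x.σ x.α,
      (∀ A ∈ Q.1.body, ∀ j, A.args j < 2 * ∑ r, x.σ.arity r) ∧ Q.1.raw = q := by
  have h : 2 ^ (2 * (x.len * x.len)) ≤ x.bound :=
    x.two_pow_le_bound (by have := x.sq_len_le; omega)
  exact RawQuery.mem_queries ((x.pow_variables_le x.α_le).trans h)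
    (fun r => (x.pow_variables_arity_le r).trans h) x.pow_length_atoms_le

theorem level_dist : TwoCQ.Level x.Q₁ x.dist x.Q₂ := by
  obtain ⟨L, hL⟩ : RawQuery.queries x.bound x.σ.unaryArities x.α ∈
      Set.range (List.map fun Q : TwoCQ x.σ x.α => Q.1.raw) := by
    rw [Set.range_list_map]
    intro q hq
    obtain ⟨Q, -, e⟩ := x.mem_queries.1 hq
    exact ⟨Q, e⟩
  have hc : x.candidates = (x.Q₁ :: x.Q₂ :: L).map fun Q => Q.1.raw := by
    rw [candidates, ← hL]
    rfl
  rw [dist, hc]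
  refine RawQuery.level_dist (fun Q _ Q' _ => RawQuery.le_raw (x.pow_length_body_le Q Q'))
    (fun Q => ?_) (by simp) (by simp)
  obtain ⟨Q', h, e, hlt⟩ := Q.2.exists_equivalent
  -- `Q''` has the same raw form as `Q'`. The containment test sees only raw forms, so the two are
  -- equivalent.
  obtain ⟨Q'', hQ'', e'⟩ := List.mem_map.1 (hL ▸ x.mem_queries.2 ⟨⟨Q', h⟩, hlt, rfl⟩)
  refine ⟨Q'', by simp [hQ''], e.trans ?_⟩
  have h1 := RawQuery.le_raw (x.pow_length_body_le ⟨Q', h⟩ Q'')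
  have h2 := RawQuery.le_raw (x.pow_length_body_le Q'' ⟨Q', h⟩)
  have h3 := RawQuery.le_raw (x.pow_length_body_le Q'' Q'')
  rw [← e'] at h1 h2
  exact ⟨h1.1 (h3.2 (.refl _)), h2.1 (h3.2 (.refl _))⟩

end DistInput

theorem mainTheorem5 :
    ∃ δ : DistInput → ℕ,
      (∀ (x : DistInput) (i : ℕ), TwoCQ.IsDist x.Q₁ i x.Q₂ ↔ δ x = i) ∧
      ∃ (M : Turing.TM2ComputableInTime encodeInput Computability.encodeNat δ)
        (p : Polynomial ℕ),
        ∀ n : ℕ, M.time n ≤ 2 ^ p.eval n :=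
  ⟨DistInput.dist, fun x i => by
    rw [TwoCQ.isDist_iff_level]
    exact ⟨fun h => x.level_dist.unique h, fun h => h ▸ x.level_dist⟩,
    DistInput.exists_computableInTime⟩
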